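/- Let $\mathfrak g$ be a finite-dimensional semisimple Lie algebra over a field $K$ of characteristic $0$ with a splitting Cartan subalgebra $\mathfrak h$, root system $\Lambda$ and nonzero root vectors $L_\lambda\in\mathfrak g_\lambda$ ($\lambda\in\Lambda$); for a root $\lambda$ let $H_\lambda\in\mathfrak h$ be half the coroot of $\lambda$, so that $[H_\lambda,L_\lambda]=L_\lambda$. Let $\lambda_0,\lambda_0^\perp\in\Lambda$ be orthogonal, and put $H=H_{\lambda_0}$, $E=L_{\lambda_0}$. Let $\pi_\perp$ be the set of roots $\mu$ such that $\lambda_0^\perp-\mu\in\Lambda$ while $\mu+\lambda_0^\perp\notin\Lambda$ and $(\lambda_0^\perp-\mu)+\lambda_0^\perp\notin\Lambda$. Let $\lambda'\neq\widetilde{\lambda'}$ be two elements of $\pi_\perp$ with $$\lambda'+\lambda_0=\lambda_0^\perp-\widetilde{\lambda'} .$$ Assume that $\lambda_0^\perp$ is the only root that is a sum of two elements of $\{\lambda',\widetilde{\lambda'},\lambda_0^\perp-\lambda',\lambda_0^\perp-\widetilde{\lambda'}\}$, that all $\lambda_0$-series of roots are short (there is no $\chi$ with $\chi,\ \chi+\lambda_0,\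 \chi+2\lambda_0$ all in $\Lambda$), and that the root vectors are normalized by $$[L_{\lambda'},L_{\lambda_0^\perp-\lambda'}]=[L_{\widetilde{\lambda'}},L_{\lambda_0^\perp-\widetilde{\lambda'}}]=L_{\lambda_0^\perp},\qquad [L_{\lambda'},E]=-L_{\lambda_0^\perp-\widetilde{\lambda'}} .$$ Let $\hbar$ be a formal parameter. A twist is an invertible $\mathcal F\in(U(\mathfrak g)\otimes U(\mathfrak g))[[\hbar]]$ with $\mathcal F\equiv1$ mod $\hbar$, $\mathcal F_{12}(\Delta\otimes\mathrm{id})\mathcal F=\mathcal F_{23}(\mathrm{id}\otimes\Delta)\mathcal F$ and $(\varepsilon\otimes\mathrm{id})\mathcal F=(\mathrm{id}\otimes\varepsilon)\mathcal F=1$; the twisted algebra $U_{\mathcal F}(\mathfrak g)$ is $U(\mathfrak g)[[\hbar]]$ with coproduct $\Delta_{\mathcal F}(a)=\mathcal F\Delta(a)\mathcal F^{-1}$; the carrier algebra of $\mathcal F$ is the least Lie subalgebra $\mathfrak c\subseteq\mathfrak g$ with $\mathcal F\in(U(\mathfrak c)\otimes U(\mathfrak c))[[\hbar]]$. Put $\sigma_0^\perp=\ln(1+\hbar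 L_{\lambda_0^\perp})$ and $$\Phi_{\mathcal J_\perp}=\exp(H_{\lambda_0^\perp}\otimes\sigma_0^\perp),\qquad \Phi_{\mathcal E_\perp}=\prod_{\mu\in\{\lambda',\widetilde{\lambda'}\}}\exp\bigl(\hbar\,L_\mu\otimes L_{\lambda_0^\perp-\mu}e^{-\frac12\sigma_0^\perp}\bigr),\qquad \mathcal F_{\mathcal B_\perp}=\Phi_{\mathcal E_\perp}\Phi_{\mathcal J_\perp},$$ $$E_{\mathcal B}=E+\hbar\,L_{\lambda_0^\perp-\widetilde{\lambda'}}L_{\lambda_0^\perp-\lambda'}e^{-\sigma_0^\perp},\qquad \mathcal F_{\mathcal{BJE}}=\exp\bigl(H\otimes\ln(1+\hbar E_{\mathcal B})\bigr)\,\Phi_{\mathcal E_\perp}\Phi_{\mathcal J_\perp}.$$ Then: 1. $\mathcal F_{\mathcal B_\perp}$ is a twist, and $H$ and $E_{\mathcal B}$ are primitive in $U_{\mathcal F_{\mathcal B_\perp}}(\mathfrak g)$. 2. $[H,E_{\mathcal B}]=E_{\mathcal B}$, and $H,E_{\mathcal B}$ are linearly independent over $K[[\hbar]]$; so they span a two-dimensional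 Borel subalgebra. 3. $\mathcal F_{\mathcal{BJE}}$ is a twist. 4. $\mathcal F_{\mathcal{BJE}}$ has a carrier algebra; it is $8$-dimensional, with basis $H,\ H_{\lambda_0^\perp},\ L_{\lambda_0},\ L_{\lambda_0^\perp},\ L_{\lambda'},\ L_{\lambda_0^\perp-\lambda'},\ L_{\widetilde{\lambda'}},\ L_{\lambda_0^\perp-\widetilde{\lambda'}}$. -/

import Mathlib

open scoped TensorProduct PowerSeries

namespace JordanianTwist

attribute [local instance 100] LieRing.ofAssociativeRing

noncomputable section

/-! ### Roots of a split semisimple Lie algebra -/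

section Roots

variable {K g : Type*} [Field K] [CharZero K] [LieRing g] [LieAlgebra K g]
  [FiniteDimensional K g] [LieAlgebra.IsKilling K g]
  (h : LieSubalgebra K g) [h.IsCartanSubalgebra]

/-- `χ` is a root of `g` with respect to the Cartan subalgebra `h`. -/
def IsRoot (χ : Module.Dual K h) : Prop :=
  χ ≠ 0 ∧ LieAlgebra.rootSpace h (χ : h → K) ≠ ⊥

/-- The Cartan generator `H_χ` dual to a root `χ`: the multiple of the Killing-form dual of `χ`
with `χ (H_χ) = 1`, that is, one half of the coroot. -/
def cartanGen (χ : Module.Dual K h) : h :=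
  (χ ((LieAlgebra.IsKilling.cartanEquivDual h).symm χ))⁻¹ •
    (LieAlgebra.IsKilling.cartanEquivDual h).symm χ

theorem two_smul_cartanGen (α : LieModule.Weight K h g) :
    2 • cartanGen h (LieModule.Weight.toLinear K h g α) = LieAlgebra.IsKilling.coroot α :=
  rfl

/-- The set of constituent roots of a root `δ`: the roots `μ` such that `δ - μ` is a root, while
neither `μ + δ` nor `(δ - μ) + δ` is a root. -/
def constituentRoots (δ : Module.Dual K h) : Set (Module.Dual K h) :=
  {μ | IsRoot h μ ∧ IsRoot h (δ - μ) ∧ ¬ IsRoot h (μ + δ) ∧ ¬ IsRoot h ((δ - μ) + δ)}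

end Roots

/-! ### Exponential and logarithm in `A⟦ħ⟧` for a noncommutative algebra `A` -/

section Series

variable {K A : Type*} [Field K] [CharZero K] [Ring A] [Algebra K A]

/-- The value `∑ₖ fₖ aᵏ` of a scalar power series `f` at an element `a` of `A⟦ħ⟧` without constant
term. The `n`-th coefficient of `aᵏ` vanishes for `k > n`, so the sum may be cut off at `n`. -/
def evalSeries (f : K⟦X⟧) (a : A⟦X⟧) : A⟦X⟧ :=
  PowerSeries.mk fun n =>
    ∑ k ∈ Finset.range (n + 1), PowerSeries.coeff k f • PowerSeries.coeff n (a ^ k)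

variable (K) in
/-- `exp a`, for `a` without constant term. -/
def hExp (a : A⟦X⟧) : A⟦X⟧ := evalSeries (PowerSeries.exp K) a

variable (K) in
/-- `ln (1 + a)`, for `a` without constant term. -/
def hLogOneAdd (a : A⟦X⟧) : A⟦X⟧ := evalSeries (PowerSeries.log K) a

end Series

/-! ### The Hopf algebra `U(g)⟦ħ⟧`, twists, and their carriers -/

section Hopf

variable (K g : Type*) [Field K] [LieRing g] [LieAlgebra K g]

/-- The universal enveloping algebra `U(g)`. -/
abbrev U := UniversalEnvelopingAlgebra K g

/-- The coproduct of `U(g)`, given on `g` by `x ↦ x ⊗ 1 + 1 ⊗ x`. -/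
def comul : U K g →ₐ[K] U K g ⊗[K] U K g :=
  UniversalEnvelopingAlgebra.lift K
    { toFun := fun x =>
        UniversalEnvelopingAlgebra.ι K x ⊗ₜ[K] 1 + 1 ⊗ₜ[K] UniversalEnvelopingAlgebra.ι K x
      map_add' := fun x y => by
        rw [map_add, TensorProduct.add_tmul, TensorProduct.tmul_add]; abel
      map_smul' := fun c x => by
        rw [map_smul, TensorProduct.tmul_smul, ← TensorProduct.smul_tmul', smul_add,
          RingHom.id_apply]
      map_lie' := fun {x y} => by
        simp only [LieHom.map_lie, LieRing.of_associative_ring_bracket, mul_add, add_mul,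
          Algebra.TensorProduct.tmul_mul_tmul, one_mul, mul_one, TensorProduct.sub_tmul,
          TensorProduct.tmul_sub]
        abel }

/-- The counit of `U(g)`, vanishing on `g`. -/
def counit : U K g →ₐ[K] K :=
  UniversalEnvelopingAlgebra.lift K (0 : g →ₗ⁅K⁆ K)

variable {K g}

/-- The embedding `g → U(g)⟦ħ⟧`. -/
def emb (x : g) : (U K g)⟦X⟧ := PowerSeries.C (UniversalEnvelopingAlgebra.ι K x)

/-- The pure tensor `a ⊗ b` in `(U(g) ⊗ U(g))⟦ħ⟧` of two elements of `U(g)⟦ħ⟧`. -/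
def tens (a b : (U K g)⟦X⟧) : (U K g ⊗[K] U K g)⟦X⟧ :=
  PowerSeries.map (Algebra.TensorProduct.includeLeft : U K g →ₐ[K] U K g ⊗[K] U K g).toRingHom a *
    PowerSeries.map
      (Algebra.TensorProduct.includeRight : U K g →ₐ[K] U K g ⊗[K] U K g).toRingHom b

/-- `Δ : U(g)⟦ħ⟧ → (U(g) ⊗ U(g))⟦ħ⟧`. -/
def hComul : (U K g)⟦X⟧ →+* (U K g ⊗[K] U K g)⟦X⟧ :=
  PowerSeries.map (comul K g).toRingHom

/-- `F ↦ F₁₂ = F ⊗ 1`. -/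
def leg12 : (U K g ⊗[K] U K g)⟦X⟧ →+* ((U K g ⊗[K] U K g) ⊗[K] U K g)⟦X⟧ :=
  PowerSeries.map (Algebra.TensorProduct.includeLeft :
    U K g ⊗[K] U K g →ₐ[K] (U K g ⊗[K] U K g) ⊗[K] U K g).toRingHom

/-- `F ↦ F₂₃ = 1 ⊗ F`. -/
def leg23 : (U K g ⊗[K] U K g)⟦X⟧ →+* ((U K g ⊗[K] U K g) ⊗[K] U K g)⟦X⟧ :=
  PowerSeries.map
    ((Algebra.TensorProduct.assoc K K K (U K g) (U K g) (U K g)).symm.toAlgHom.comp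
      (Algebra.TensorProduct.includeRight :
        U K g ⊗[K] U K g →ₐ[K] U K g ⊗[K] (U K g ⊗[K] U K g))).toRingHom

/-- `Δ ⊗ id`. -/
def comulId : (U K g ⊗[K] U K g)⟦X⟧ →+* ((U K g ⊗[K] U K g) ⊗[K] U K g)⟦X⟧ :=
  PowerSeries.map (Algebra.TensorProduct.map (comul K g) (AlgHom.id K (U K g))).toRingHom

/-- `id ⊗ Δ`. -/
def idComul : (U K g ⊗[K] U K g)⟦X⟧ →+* ((U K g ⊗[K] U K g) ⊗[K] U K g)⟦X⟧ :=
  PowerSeries.map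
    ((Algebra.TensorProduct.assoc K K K (U K g) (U K g) (U K g)).symm.toAlgHom.comp
      (Algebra.TensorProduct.map (AlgHom.id K (U K g)) (comul K g))).toRingHom

/-- `ε ⊗ id`. -/
def counitId : (U K g ⊗[K] U K g)⟦X⟧ →+* (U K g)⟦X⟧ :=
  PowerSeries.map
    ((Algebra.TensorProduct.lid K (U K g)).toAlgHom.comp
      (Algebra.TensorProduct.map (counit K g) (AlgHom.id K (U K g)))).toRingHom

/-- `id ⊗ ε`. -/
def idCounit : (U K g ⊗[K] U K g)⟦X⟧ →+* (U K g)⟦X⟧ :=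
  PowerSeries.map
    ((Algebra.TensorProduct.rid K K (U K g)).toAlgHom.comp
      (Algebra.TensorProduct.map (AlgHom.id K (U K g)) (counit K g))).toRingHom

/-- `F` is a (Drinfeld) twist of `U(g)⟦ħ⟧`: it is an invertible element with `F ≡ 1` modulo `ħ`
that satisfies the 2-cocycle equation and is counital. -/
structure IsTwist (F : (U K g ⊗[K] U K g)⟦X⟧) : Prop where
  isUnit : IsUnit F
  constantCoeff_eq_one : PowerSeries.constantCoeff F = 1
  cocycle : leg12 F * comulId F = leg23 F * idComul F
  counit_left : counitId F = 1
  counit_right : idCounit F = 1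

/-- The twisted coproduct `Δ_F(a) = F Δ(a) F⁻¹`. -/
def twistedComul (F : (U K g ⊗[K] U K g)⟦X⟧) (a : (U K g)⟦X⟧) : (U K g ⊗[K] U K g)⟦X⟧ :=
  F * hComul a * Ring.inverse F

/-- `a` is a primitive element of the twisted algebra `U_F(g)`. -/
def IsPrimitiveFor (F : (U K g ⊗[K] U K g)⟦X⟧) (a : (U K g)⟦X⟧) : Prop :=
  twistedComul F a = tens a 1 + tens 1 a

/-- `x, y` are a basis, over `K⟦ħ⟧`, of a two-dimensional Borel subalgebra of `U(g)⟦ħ⟧`: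
`[x, y] = y`, and `x`, `y` are linearly independent over `K⟦ħ⟧`. -/
structure IsBorelBasis (x y : (U K g)⟦X⟧) : Prop where
  lie_eq : x * y - y * x = y
  independent : ∀ p q : K⟦X⟧,
    PowerSeries.map (algebraMap K (U K g)) p * x + PowerSeries.map (algebraMap K (U K g)) q * y = 0 →
      p = 0 ∧ q = 0

/-- `F` lies in `(U(c) ⊗ U(c))⟦ħ⟧`, for a Lie subalgebra `c` of `g`. -/
def IsSupportedOn (F : (U K g ⊗[K] U K g)⟦X⟧) (c : LieSubalgebra K g) : Prop :=
  ∀ n : ℕ, PowerSeries.coeff n F ∈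
    (Algebra.TensorProduct.map
      (UniversalEnvelopingAlgebra.lift K ((UniversalEnvelopingAlgebra.ι K).comp c.incl))
      (UniversalEnvelopingAlgebra.lift K ((UniversalEnvelopingAlgebra.ι K).comp c.incl)) :
        U K c ⊗[K] U K c →ₐ[K] U K g ⊗[K] U K g).range

/-- `c` is the carrier algebra of `F`: the least Lie subalgebra `c` of `g` such that `F` lies in
`(U(c) ⊗ U(c))⟦ħ⟧`. -/
def IsCarrier (F : (U K g ⊗[K] U K g)⟦X⟧) (c : LieSubalgebra K g) : Prop :=
  IsLeast {d : LieSubalgebra K g | IsSupportedOn F d} c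

end Hopf

/-! ### The extended Jordanian twist and the deformed Borel subalgebra -/

section Twist

variable {K g : Type*} [Field K] [CharZero K] [LieRing g] [LieAlgebra K g]

/-- `σ = ln (1 + ħ x)`. -/
def sigma (x : g) : (U K g)⟦X⟧ := hLogOneAdd K (PowerSeries.X * emb x)

/-- The Jordanian factor `exp (H ⊗ ln (1 + ħ y))`. -/
def jordanianFactor (H : g) (y : (U K g)⟦X⟧) : (U K g ⊗[K] U K g)⟦X⟧ :=
  hExp K (tens (emb H) (hLogOneAdd K (PowerSeries.X * y)))

/-- The extension factor `exp (ħ a ⊗ b e^{-σ/2})`, with `σ = ln (1 + ħ x)`. -/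
def extensionFactor (a b x : g) : (U K g ⊗[K] U K g)⟦X⟧ :=
  hExp K (PowerSeries.X * tens (emb a) (emb b * hExp K (-((2 : K)⁻¹ • sigma x))))

/-- The element `E_B = E + ħ b a e^{-σ}`, with `σ = ln (1 + ħ x)`. -/
def deformedE (E b a x : g) : (U K g)⟦X⟧ :=
  emb E + PowerSeries.X * (emb b * emb a * hExp K (-(sigma x)))

end Twist

end

end JordanianTwist

/-! Write P = L_{λ₀⊥}, σ = ln(1+ħP), A₁ = L_{λ'}, B₁ = L_{λ₀⊥-λ'}, let A₂, B₂ be the same for the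
second constituent root, and put b_i = B_i e^{-σ/2}. The twist is a product in which each factor
twists the algebra already twisted by the factors to its right (`IsTwist.mul_left`). Two kinds of
factor occur. If H, y are primitive and [H,y] = y, then exp(H ⊗ ln(1+ħy)) is a twist, because it
makes 1+ħy group-like (`IsTwist.jordanian`). If Δ(A) = A⊗q + 1⊗A, Δ(B) = B⊗1 + q'⊗B and q = q' +
ħ[A,B], with the commutations stated there, then exp(ħ A⊗B) is a twist (`IsTwist.extension`); here A
= A_i, B = b_i, q = e^{σ/2}, q' = e^{-σ/2}.

After these factors H is still primitive, since A_i and B_i have opposite H-weights. The coproduct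
of E acquires the terms -ħB₂⊗b₁ - ħB₁⊗b₂ - ħ²P⊗b₁b₂, and these are exactly what the coproduct of the
correction ħb₂b₁ cancels (`semiconjBy_E`, `semiconjBy_deformedE`). So H, E_B is again a primitive
Borel pair and the Jordanian criterion applies a second time.

For the carrier, the ħ-coefficient of the full twist is H⊗E + A₁⊗B₁ + A₂⊗B₂ + H_⊥⊗P. Contracting
either leg with functionals dual to the eight independent vectors places each of them in the image
of U(d), for every supporting subalgebra d, and `mem_of_ι_mem_range` brings them back to d. That
lemma avoids the Poincaré–Birkhoff–Witt theorem: multiplication after Δ acts by 2ⁿ on degree n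
modulo lower degree, so a primitive element has degree at most 1.

All of this depends only on the 28 brackets in `CarrierRelations`; `carrierRelations_of_roots`
derives them from the hypotheses on roots. -/

namespace JordanianTwist

/-! ### Substitution of an element without constant term into a scalar power series. -/

section SeriesLemmas

variable {K A B : Type*} [Field K] [Ring A] [Algebra K A] [Ring B] [Algebra K B]

open PowerSeries Finset

theorem coeff_pow_eq_zero_of_lt {a : A⟦X⟧} (ha : constantCoeff a = 0) {n k : ℕ} (h : n < k) :
    coeff n (a ^ k) = 0 := by
  obtain ⟨b, rfl⟩ := X_dvd_iff.mpr ha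
  rw [(commute_X b).symm.mul_pow, coeff_X_pow_mul', if_neg (by omega)]

theorem coeff_pow_mul_pow_eq_zero_of_lt {a b : A⟦X⟧} (ha : constantCoeff a = 0)
    (hb : constantCoeff b = 0) {n i j : ℕ} (h : n < i + j) : coeff n (a ^ i * b ^ j) = 0 := by
  rw [coeff_mul]
  refine sum_eq_zero fun p hp => ?_
  rw [HasAntidiagonal.mem_antidiagonal] at hp
  rcases lt_or_ge p.1 i with h1 | h1
  · rw [coeff_pow_eq_zero_of_lt ha h1, zero_mul]
  · rw [coeff_pow_eq_zero_of_lt hb (by omega : p.2 < j), mul_zero]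

/-- The cut-off may be any bound beyond n, which lets sums for different coefficients share one
index range. -/
theorem coeff_evalSeries (f : K⟦X⟧) {a : A⟦X⟧} (ha : constantCoeff a = 0) {n N : ℕ} (h : n < N) :
    coeff n (evalSeries f a) = ∑ k ∈ range N, coeff k f • coeff n (a ^ k) := by
  rw [evalSeries, coeff_mk]
  refine sum_subset (range_mono h) fun k _ hk => ?_
  rw [coeff_pow_eq_zero_of_lt ha (by simpa using hk), smul_zero]

theorem constantCoeff_evalSeries (f : K⟦X⟧) (a : A⟦X⟧) :
    constantCoeff (evalSeries f a) = constantCoeff f • 1 := by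
  rw [← coeff_zero_eq_constantCoeff_apply, evalSeries, coeff_mk]
  simp

theorem coeff_one_evalSeries (f : K⟦X⟧) (a : A⟦X⟧) :
    coeff 1 (evalSeries f a) = coeff 1 f • coeff 1 a := by
  rw [evalSeries, coeff_mk]
  simp [sum_range_succ, coeff_one]

theorem coeff_evalSeries_mul_evalSeries (f g : K⟦X⟧) {a b : A⟦X⟧} (ha : constantCoeff a = 0)
    (hb : constantCoeff b = 0) (n : ℕ) :
    coeff n (evalSeries f a * evalSeries g b) = ∑ k ∈ range (n + 1), ∑ p ∈ antidiagonal k,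
      (coeff p.1 f * coeff p.2 g) • coeff n (a ^ p.1 * b ^ p.2) := by
  have h1 : coeff n (evalSeries f a * evalSeries g b) = ∑ i ∈ range (n + 1), ∑ j ∈ range (n + 1),
      (coeff i f * coeff j g) • coeff n (a ^ i * b ^ j) := by
    rw [coeff_mul]
    have h2 : ∀ p ∈ antidiagonal n, coeff p.1 (evalSeries f a) * coeff p.2 (evalSeries g b) =
        ∑ i ∈ range (n + 1), ∑ j ∈ range (n + 1),
          (coeff i f * coeff j g) • (coeff p.1 (a ^ i) * coeff p.2 (b ^ j)) := by
      intro p hp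
      rw [HasAntidiagonal.mem_antidiagonal] at hp
      rw [coeff_evalSeries f ha (by omega : p.1 < n + 1),
        coeff_evalSeries g hb (by omega : p.2 < n + 1), sum_mul_sum]
      simp only [smul_mul_smul_comm]
    rw [sum_congr rfl h2, sum_comm]
    refine sum_congr rfl fun i _ => ?_
    rw [sum_comm]
    refine sum_congr rfl fun j _ => ?_
    rw [coeff_mul, smul_sum]
  -- The terms of the square with i + j > n vanish; the remaining triangle is regrouped by the value
  -- of i + j.
  rw [h1, ← sum_product', sum_sigma']
  refine (sum_subset_zero_on_sdiff (s₁ := ((range (n + 1)) ×ˢ (range (n + 1))).filter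
    fun p => p.1 + p.2 ≤ n) (filter_subset _ _) ?_ fun _ _ => rfl).symm.trans ?_
  · intro p hp
    simp only [mem_sdiff, mem_filter, not_and, not_le] at hp
    rw [coeff_pow_mul_pow_eq_zero_of_lt ha hb (hp.2 hp.1), smul_zero]
  · refine sum_bij' (fun p _ => ⟨p.1 + p.2, p⟩) (fun q _ => q.2) ?_ ?_ ?_ ?_ ?_
    · intro p hp
      simp only [mem_filter] at hp
      simp only [mem_sigma, mem_range, HasAntidiagonal.mem_antidiagonal]
      exact ⟨by omega, trivial⟩
    · rintro ⟨k, p⟩ hq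
      simp only [mem_sigma, mem_range, HasAntidiagonal.mem_antidiagonal] at hq
      simp only [mem_filter, mem_product, mem_range]
      omega
    · intro p _; rfl
    · rintro ⟨k, p⟩ hq
      simp only [mem_sigma, mem_range, HasAntidiagonal.mem_antidiagonal] at hq
      obtain ⟨_, rfl⟩ := hq
      rfl
    · intro p _; rfl

theorem evalSeries_mul (f g : K⟦X⟧) {a : A⟦X⟧} (ha : constantCoeff a = 0) :
    evalSeries (f * g) a = evalSeries f a * evalSeries g a := by
  ext n
  rw [coeff_evalSeries_mul_evalSeries f g ha ha, evalSeries, coeff_mk]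
  refine sum_congr rfl fun k _ => ?_
  rw [coeff_mul, sum_smul]
  refine sum_congr rfl fun p hp => ?_
  rw [← pow_add, HasAntidiagonal.mem_antidiagonal.mp hp]

theorem evalSeries_one (a : A⟦X⟧) : evalSeries (1 : K⟦X⟧) a = 1 := by
  ext n
  rw [evalSeries, coeff_mk, sum_eq_single 0]
  · simp
  · intro k _ hk
    rw [coeff_one, if_neg hk, zero_smul]
  · simp

theorem evalSeries_X {a : A⟦X⟧} (ha : constantCoeff a = 0) : evalSeries (X : K⟦X⟧) a = a := by
  ext n
  -- The bound n + 2 keeps the index 1 in range even for n = 0.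
  rw [coeff_evalSeries X ha (by omega : n < n + 2), sum_eq_single 1]
  · simp
  · intro k _ hk
    rw [coeff_X, if_neg hk, zero_smul]
  · simp

theorem evalSeries_add (f g : K⟦X⟧) (a : A⟦X⟧) :
    evalSeries (f + g) a = evalSeries f a + evalSeries g a := by
  ext n
  simp only [evalSeries, coeff_mk, map_add, add_smul, sum_add_distrib]

theorem evalSeries_pow (f : K⟦X⟧) {a : A⟦X⟧} (ha : constantCoeff a = 0) (k : ℕ) :
    evalSeries (f ^ k) a = evalSeries f a ^ k := by
  induction k with
  | zero => rw [pow_zero, pow_zero, evalSeries_one]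
  | succ k ih => rw [pow_succ, pow_succ, evalSeries_mul _ _ ha, ih]

theorem evalSeries_evalSeries (f : K⟦X⟧) {g : K⟦X⟧} (hg : constantCoeff g = 0) {a : A⟦X⟧}
    (ha : constantCoeff a = 0) :
    evalSeries (evalSeries f g) a = evalSeries f (evalSeries g a) := by
  ext n
  rw [evalSeries, coeff_mk, evalSeries.eq_1 f (evalSeries g a), coeff_mk]
  have h1 : ∀ k ∈ range (n + 1), coeff k (evalSeries f g) • coeff n (a ^ k) =
      ∑ j ∈ range (n + 1), coeff j f • coeff k (g ^ j) • coeff n (a ^ k) := by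
    intro k hk
    rw [coeff_evalSeries f hg (mem_range.mp hk), sum_smul]
    simp only [smul_assoc]
  rw [sum_congr rfl h1, sum_comm]
  refine sum_congr rfl fun j _ => ?_
  rw [← evalSeries_pow g ha, ← smul_sum]
  congr 1
  rw [evalSeries, coeff_mk]

theorem map_evalSeries (φ : A →ₐ[K] B) (f : K⟦X⟧) (a : A⟦X⟧) :
    PowerSeries.map φ.toRingHom (evalSeries f a) =
      evalSeries f (PowerSeries.map φ.toRingHom a) := by
  ext n
  simp only [evalSeries, coeff_map, coeff_mk, map_sum, ← map_pow]
  refine sum_congr rfl fun k _ => ?_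
  exact map_smul φ _ _

theorem coeff_mul_evalSeries (c : A⟦X⟧) (f : K⟦X⟧) {a : A⟦X⟧} (ha : constantCoeff a = 0)
    {n N : ℕ} (h : n < N) :
    coeff n (c * evalSeries f a) = ∑ k ∈ range N, coeff k f • coeff n (c * a ^ k) := by
  have h1 : ∀ p ∈ antidiagonal n, coeff p.1 c * coeff p.2 (evalSeries f a) =
      ∑ k ∈ range N, coeff k f • (coeff p.1 c * coeff p.2 (a ^ k)) := by
    intro p hp
    rw [HasAntidiagonal.mem_antidiagonal] at hp
    rw [coeff_evalSeries f ha (by omega : p.2 < N), mul_sum]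
    simp only [mul_smul_comm]
  rw [coeff_mul, sum_congr rfl h1, sum_comm]
  simp only [← smul_sum, ← coeff_mul]

theorem coeff_evalSeries_mul (c : A⟦X⟧) (f : K⟦X⟧) {a : A⟦X⟧} (ha : constantCoeff a = 0)
    {n N : ℕ} (h : n < N) :
    coeff n (evalSeries f a * c) = ∑ k ∈ range N, coeff k f • coeff n (a ^ k * c) := by
  have h1 : ∀ p ∈ antidiagonal n, coeff p.1 (evalSeries f a) * coeff p.2 c =
      ∑ k ∈ range N, coeff k f • (coeff p.1 (a ^ k) * coeff p.2 c) := by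
    intro p hp
    rw [HasAntidiagonal.mem_antidiagonal] at hp
    rw [coeff_evalSeries f ha (by omega : p.1 < N), sum_mul]
    simp only [smul_mul_assoc]
  rw [coeff_mul, sum_congr rfl h1, sum_comm]
  simp only [← smul_sum, ← coeff_mul]

/-- Conjugation passes through powers, hence through every series; this is how conjugating an
exponential or a logarithm reduces to conjugating its argument. -/
theorem semiconjBy_evalSeries {c a b : A⟦X⟧} (h : SemiconjBy c a b)
    (ha : constantCoeff a = 0) (hb : constantCoeff b = 0) (f : K⟦X⟧) :
    SemiconjBy c (evalSeries f a) (evalSeries f b) := by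
  ext n
  rw [coeff_mul_evalSeries c f ha n.lt_succ_self, coeff_evalSeries_mul c f hb n.lt_succ_self]
  simp only [(h.pow_right _).eq]

theorem commute_evalSeries {c a : A⟦X⟧} (h : Commute c a) (ha : constantCoeff a = 0)
    (f : K⟦X⟧) : Commute c (evalSeries f a) :=
  semiconjBy_evalSeries h ha ha f

theorem evalSeries_eq_subst (f : K⟦X⟧) {g : K⟦X⟧} (hg : constantCoeff g = 0) :
    evalSeries f g = f.subst g := by
  ext n
  rw [coeff_subst' (HasSubst.of_constantCoeff_zero' hg), evalSeries, coeff_mk,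
    finsum_eq_sum_of_support_subset _ (s := range (n + 1))]
  intro k hk
  by_contra h
  refine hk ?_
  change coeff k f • coeff n (g ^ k) = 0
  rw [coeff_pow_eq_zero_of_lt hg (by simpa using h), smul_zero]

end SeriesLemmas

/-! ### Functional equations of the exponential and the logarithm, and conjugation by exponentials.
-/

section ExpLog

variable {K A B : Type*} [Field K] [CharZero K] [Ring A] [Algebra K A] [Ring B] [Algebra K B]

open PowerSeries Finset

@[simp]
theorem constantCoeff_hExp (a : A⟦X⟧) : constantCoeff (hExp K a) = 1 := by
  rw [hExp, constantCoeff_evalSeries, constantCoeff_exp, one_smul]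

@[simp]
theorem constantCoeff_hLogOneAdd (a : A⟦X⟧) : constantCoeff (hLogOneAdd K a) = 0 := by
  rw [hLogOneAdd, constantCoeff_evalSeries, constantCoeff_log, zero_smul]

theorem coeff_one_hExp (a : A⟦X⟧) : coeff 1 (hExp K a) = coeff 1 a := by
  rw [hExp, coeff_one_evalSeries]; simp

theorem coeff_one_hLogOneAdd (a : A⟦X⟧) : coeff 1 (hLogOneAdd K a) = coeff 1 a := by
  rw [hLogOneAdd, coeff_one_evalSeries, coeff_one_log, one_smul]

@[simp]
theorem hExp_zero : hExp K (0 : A⟦X⟧) = 1 := by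
  ext n
  rw [hExp, evalSeries, coeff_mk, sum_eq_single 0]
  · simp
  · intro k _ hk
    rw [zero_pow hk, map_zero, smul_zero]
  · simp

@[simp]
theorem hLogOneAdd_zero : hLogOneAdd K (0 : A⟦X⟧) = 0 := by
  ext n
  rw [hLogOneAdd, evalSeries, coeff_mk, sum_eq_zero]
  · simp
  · intro k _
    rcases eq_or_ne k 0 with rfl | hk
    · simp
    · rw [zero_pow hk, map_zero, smul_zero]

theorem map_hExp (φ : A →ₐ[K] B) (a : A⟦X⟧) :
    PowerSeries.map φ.toRingHom (hExp K a) = hExp K (PowerSeries.map φ.toRingHom a) :=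
  map_evalSeries φ _ a

theorem map_hLogOneAdd (φ : A →ₐ[K] B) (a : A⟦X⟧) :
    PowerSeries.map φ.toRingHom (hLogOneAdd K a) = hLogOneAdd K (PowerSeries.map φ.toRingHom a) :=
  map_evalSeries φ _ a

theorem hExp_add {a b : A⟦X⟧} (hab : Commute a b) (ha : constantCoeff a = 0)
    (hb : constantCoeff b = 0) : hExp K (a + b) = hExp K a * hExp K b := by
  ext n
  rw [hExp, hExp, hExp, coeff_evalSeries_mul_evalSeries _ _ ha hb, evalSeries, coeff_mk]
  refine sum_congr rfl fun k _ => ?_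
  rw [hab.add_pow', map_sum, smul_sum]
  refine sum_congr rfl fun p hp => ?_
  rw [map_nsmul, ← Nat.cast_smul_eq_nsmul K, smul_smul]
  congr 1
  obtain rfl := HasAntidiagonal.mem_antidiagonal.mp hp
  simp only [coeff_exp, one_div, map_inv₀, map_natCast]
  rw [Nat.choose_symm_add, Nat.add_choose,
    Nat.cast_div_charZero (Nat.factorial_mul_factorial_dvd_factorial_add _ _)]
  have := Nat.factorial_ne_zero (p.1 + p.2)
  push_cast
  field_simp

theorem hExp_mul_hExp_neg {a : A⟦X⟧} (ha : constantCoeff a = 0) :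
    hExp K a * hExp K (-a) = 1 := by
  rw [← hExp_add (Commute.neg_right (Commute.refl a)) ha (by simp [ha]), add_neg_cancel, hExp_zero]

theorem hExp_neg_mul_hExp {a : A⟦X⟧} (ha : constantCoeff a = 0) :
    hExp K (-a) * hExp K a = 1 := by
  rw [← hExp_add (Commute.neg_left (Commute.refl a)) (by simp [ha]) ha, neg_add_cancel, hExp_zero]

theorem isUnit_hExp {a : A⟦X⟧} (ha : constantCoeff a = 0) : IsUnit (hExp K a) :=
  ⟨⟨_, _, hExp_mul_hExp_neg (K := K) ha, hExp_neg_mul_hExp ha⟩, rfl⟩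

theorem derivative_log_mul : d⁄dX K (PowerSeries.log K) * (1 + X) = 1 := by
  ext n
  rw [deriv_log, mul_add, mul_one]
  cases n with
  | zero => simp
  | succ n => simp [coeff_succ_mul_X, coeff_one, pow_succ]

/-- The composite u satisfies u'(1+X) = u and u(0) = 1. Comparing coefficients gives (n+1)u_{n+1} +
n u_n = u_n, so u₁ = 1 and everything beyond vanishes. -/
theorem exp_subst_log : (PowerSeries.exp K).subst (PowerSeries.log K) = 1 + X := by
  set u := (PowerSeries.exp K).subst (PowerSeries.log K) with hu
  have hd : d⁄dX K u = u * d⁄dX K (PowerSeries.log K) := by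
    rw [hu, derivative_subst HasSubst.log, derivative_exp]
  have h1 : d⁄dX K u * (1 + X) = u := by rw [hd, mul_assoc, derivative_log_mul, mul_one]
  have h0 : constantCoeff u = 1 := by
    rw [hu, ← evalSeries_eq_subst _ constantCoeff_log, constantCoeff_evalSeries,
      constantCoeff_exp, one_smul]
  have hrec : ∀ n : ℕ, coeff (n + 1) u * (n + 1) + coeff n u * n = coeff n u := by
    intro n
    have h2 := congrArg (coeff n) h1
    rw [mul_add, mul_one, map_add, coeff_derivative] at h2
    cases n with
    | zero => simpa using h2
    | succ n => rw [coeff_succ_mul_X, coeff_derivative] at h2; simpa using h2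
  have hsucc : ∀ n : ℕ, coeff (n + 2) u = 0 := by
    intro n
    induction n with
    | zero =>
      have h2 := hrec 1
      have h3 : coeff 2 u * (2 : K) = 0 := by
        push_cast at h2; linear_combination h2
      simpa using h3
    | succ n ih =>
      have h2 := hrec (n + 2)
      rw [ih, zero_mul, add_zero] at h2
      have h3 : ((n + 2 : ℕ) + 1 : K) ≠ 0 := by exact_mod_cast (n + 2).succ_ne_zero
      exact (mul_eq_zero.mp h2).resolve_right h3
  ext n
  match n with
  | 0 => simpa using h0
  | 1 =>
    have := hrec 0
    simp only [coeff_zero_eq_constantCoeff_apply, h0] at this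
    simpa [coeff_one] using this
  | n + 2 => rw [hsucc]; simp [coeff_one, coeff_X]

/-- Both sides have constant term 0 and derivative 1: substituting exp - 1 into log'·(1+X) = 1 is
the chain rule computation. -/
theorem log_subst_exp_sub_one :
    (PowerSeries.log K).subst (PowerSeries.exp K - 1) = X := by
  have h1 := congrArg (PowerSeries.subst (PowerSeries.exp K - 1)) (derivative_log_mul (K := K))
  have hs : HasSubst (PowerSeries.exp K - 1) := HasSubst.exp_sub_one
  have hone : PowerSeries.subst (PowerSeries.exp K - 1) (1 : K⟦X⟧) = (1 : K⟦X⟧) := by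
    rw [← coe_substAlgHom hs, map_one]
  rw [subst_mul hs, subst_add hs, subst_X hs, hone, add_sub_cancel] at h1
  refine derivative.ext ?_ ?_
  · rw [derivative_subst hs, map_sub, derivative_exp, Derivation.map_one_eq_zero, sub_zero, h1,
      derivative_X]
  · rw [← evalSeries_eq_subst _ (by simp), constantCoeff_evalSeries]
    simp

theorem hExp_hLogOneAdd {a : A⟦X⟧} (ha : constantCoeff a = 0) :
    hExp K (hLogOneAdd K a) = 1 + a := by
  rw [hExp, hLogOneAdd, ← evalSeries_evalSeries _ constantCoeff_log ha,
    evalSeries_eq_subst _ constantCoeff_log, exp_subst_log, evalSeries_add, evalSeries_one,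
    evalSeries_X ha]

theorem hLogOneAdd_hExp_sub_one {a : A⟦X⟧} (ha : constantCoeff a = 0) :
    hLogOneAdd K (hExp K a - 1) = a := by
  have h1 : hExp K a - 1 = evalSeries (PowerSeries.exp K - 1) a := by
    rw [eq_comm, eq_sub_iff_add_eq, ← evalSeries_one (K := K) a, ← evalSeries_add, sub_add_cancel,
      hExp]
  have h2 : constantCoeff (PowerSeries.exp K - 1) = 0 := by simp
  rw [h1, hLogOneAdd, ← evalSeries_evalSeries _ h2 ha, evalSeries_eq_subst _ h2,
    log_subst_exp_sub_one, evalSeries_X ha]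

/-- The argument on the left is (1+a)(1+b) - 1, so this is additivity of the logarithm. It turns a
group-like 1+ħy into a primitive ln(1+ħy). -/
theorem hLogOneAdd_add_add_mul {a b : A⟦X⟧} (hab : Commute a b) (ha : constantCoeff a = 0)
    (hb : constantCoeff b = 0) :
    hLogOneAdd K (a + b + a * b) = hLogOneAdd K a + hLogOneAdd K b := by
  have hc : Commute (hLogOneAdd K a) (hLogOneAdd K b) :=
    commute_evalSeries (commute_evalSeries hab hb _).symm ha _ |>.symm
  rw [← hLogOneAdd_hExp_sub_one (K := K) (a := hLogOneAdd K a + hLogOneAdd K b) (by simp),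
    hExp_add hc (by simp) (by simp), hExp_hLogOneAdd ha, hExp_hLogOneAdd hb]
  congr 1
  noncomm_ring

theorem pow_mul_eq_of_commutator {a y z : A} (hy : a * y = y * a + z) (hz : Commute a z)
    (k : ℕ) : a ^ (k + 1) * y = y * a ^ (k + 1) + (k + 1 : ℕ) • (z * a ^ k) := by
  induction k with
  | zero => simp [hy]
  | succ k ih =>
    rw [pow_succ' a (k + 1), mul_assoc, ih, mul_add, ← mul_assoc, hy, mul_smul_comm,
      ← mul_assoc a z, hz.eq, add_mul, mul_assoc z a, ← pow_succ', mul_assoc y a, ← pow_succ',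
      add_assoc, succ_nsmul' _ (k + 1)]

/-- The series exp(ad a) y stops after its linear term, because a commutes with z = [a,y]. -/
theorem semiconjBy_hExp_of_commutator {a y z : A⟦X⟧} (ha : constantCoeff a = 0)
    (hy : a * y = y * a + z) (hz : Commute a z) : SemiconjBy (hExp K a) y (y + z) := by
  ext n
  -- The y-sums get one term more than the z-sum: after their zeroth term is split off, the factor
  -- (k+1)/(k+1)! = 1/k! matches the sums index by index.
  rw [add_mul, map_add, hExp, coeff_evalSeries_mul y _ ha (by omega : n < n + 2),
    coeff_mul_evalSeries y _ ha (by omega : n < n + 2),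
    coeff_mul_evalSeries z _ ha (by omega : n < n + 1), sum_range_succ', sum_range_succ' _ (n + 1)]
  simp only [pow_mul_eq_of_commutator hy hz, map_add, smul_add, sum_add_distrib, map_nsmul]
  have h : ∀ k ∈ range (n + 1), coeff (k + 1) (PowerSeries.exp K) •
      (k + 1) • coeff n (z * a ^ k) = coeff k (PowerSeries.exp K) • coeff n (z * a ^ k) := by
    intro k _
    rw [← Nat.cast_smul_eq_nsmul K, smul_smul]
    congr 1
    simp only [coeff_exp, one_div, map_inv₀, map_natCast, Nat.factorial_succ]
    have := Nat.cast_ne_zero (R := K).mpr k.factorial_ne_zero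
    have := Nat.cast_ne_zero (R := K).mpr k.succ_ne_zero
    push_cast at *
    field_simp
  rw [sum_congr rfl h]
  simp only [pow_zero, one_mul, mul_one]
  abel

theorem semiconjBy_hExp {c a b : A⟦X⟧} (h : SemiconjBy c a b)
    (ha : constantCoeff a = 0) (hb : constantCoeff b = 0) :
    SemiconjBy c (hExp K a) (hExp K b) :=
  semiconjBy_evalSeries h ha hb _

theorem semiconjBy_hLogOneAdd {c a b : A⟦X⟧} (h : SemiconjBy c a b)
    (ha : constantCoeff a = 0) (hb : constantCoeff b = 0) :
    SemiconjBy c (hLogOneAdd K a) (hLogOneAdd K b) :=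
  semiconjBy_evalSeries h ha hb _

/-- If `a b = b (a + s)` with `a` and `s` commuting, then conjugation by `exp a` multiplies `b`
by `exp s`. -/
theorem semiconjBy_hExp_of_shift {a b s : A⟦X⟧} (ha : constantCoeff a = 0)
    (hs : constantCoeff s = 0) (hb : a * b = b * (a + s)) (has : Commute a s) :
    SemiconjBy (hExp K a) b (b * hExp K s) := by
  have h : SemiconjBy b (a + s) a := hb.symm
  have h1 := semiconjBy_hExp (K := K) h (by simp [ha, hs]) ha
  rw [SemiconjBy, ← h1.eq, add_comm a s, hExp_add has.symm hs ha, mul_assoc]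

end ExpLog

end JordanianTwist

/-! ### Tensor legs, coproducts, and twisting an already twisted algebra. -/

namespace JordanianTwist

open PowerSeries

theorem commute_map_map {A B C : Type*} [Ring A] [Ring B] [Ring C] {φ : A →+* C} {ψ : B →+* C}
    (h : ∀ x y, Commute (φ x) (ψ y)) (a : A⟦X⟧) (b : B⟦X⟧) :
    Commute (PowerSeries.map φ a) (PowerSeries.map ψ b) := by
  ext n
  rw [coeff_mul, coeff_mul, ← Finset.Nat.sum_antidiagonal_swap]
  refine Finset.sum_congr rfl fun p _ => ?_
  simp only [coeff_map, Prod.fst_swap, Prod.snd_swap]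
  exact h _ _

theorem mul_X_mul {A : Type*} [Ring A] (a b : A⟦X⟧) : a * (X * b) = X * (a * b) := by
  rw [← mul_assoc, (commute_X a).eq, mul_assoc]

theorem commute_X_mul_X_mul {A : Type*} [Ring A] {a b : A⟦X⟧} (h : Commute a b) :
    Commute (X * a) (X * b) :=
  Commute.mul_left (commute_X _).symm ((commute_X a).mul_right h)

section Legs

variable {K g : Type*} [Field K] [LieRing g] [LieAlgebra K g]

/-- `a ↦ a ⊗ 1`. -/
noncomputable def inl : (U K g)⟦X⟧ →+* (U K g ⊗[K] U K g)⟦X⟧ :=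
  PowerSeries.map (Algebra.TensorProduct.includeLeft : U K g →ₐ[K] U K g ⊗[K] U K g).toRingHom

/-- `b ↦ 1 ⊗ b`. -/
noncomputable def inr : (U K g)⟦X⟧ →+* (U K g ⊗[K] U K g)⟦X⟧ :=
  PowerSeries.map (Algebra.TensorProduct.includeRight : U K g →ₐ[K] U K g ⊗[K] U K g).toRingHom

/-- `a ↦ a ⊗ 1 ⊗ 1`. -/
noncomputable def inFst : (U K g)⟦X⟧ →+* ((U K g ⊗[K] U K g) ⊗[K] U K g)⟦X⟧ := leg12.comp inl

/-- `a ↦ 1 ⊗ a ⊗ 1`. -/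
noncomputable def inSnd : (U K g)⟦X⟧ →+* ((U K g ⊗[K] U K g) ⊗[K] U K g)⟦X⟧ := leg12.comp inr

/-- `a ↦ 1 ⊗ 1 ⊗ a`. -/
noncomputable def inThd : (U K g)⟦X⟧ →+* ((U K g ⊗[K] U K g) ⊗[K] U K g)⟦X⟧ :=
  PowerSeries.map (Algebra.TensorProduct.includeRight :
    U K g →ₐ[K] (U K g ⊗[K] U K g) ⊗[K] U K g).toRingHom

/-- The counit of `U(g)⟦ħ⟧`, with values in the scalars of `U(g)⟦ħ⟧`. -/
noncomputable def hCounit : (U K g)⟦X⟧ →+* (U K g)⟦X⟧ :=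
  PowerSeries.map ((Algebra.ofId K (U K g)).comp (counit K g)).toRingHom

theorem tens_eq (a b : (U K g)⟦X⟧) : tens a b = inl a * inr b := rfl

theorem commute_inl_inr (a b : (U K g)⟦X⟧) : Commute (inl a) (inr b) :=
  commute_map_map (fun x y => by simp [Commute, SemiconjBy]) a b

theorem leg12_inl (a : (U K g)⟦X⟧) : leg12 (inl a) = inFst a := rfl

theorem leg12_inr (a : (U K g)⟦X⟧) : leg12 (inr a) = inSnd a := rfl

theorem leg23_inl (a : (U K g)⟦X⟧) : leg23 (inl a) = inSnd a := by
  ext n; simp [leg23, inl, inSnd, leg12, inr]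

theorem leg23_inr (a : (U K g)⟦X⟧) : leg23 (inr a) = inThd a := by
  ext n; simp [leg23, inr, inThd, Algebra.TensorProduct.one_def]

theorem comulId_inl (a : (U K g)⟦X⟧) : comulId (inl a) = leg12 (hComul a) := by
  ext n; simp [comulId, inl, leg12, hComul]

theorem comulId_inr (a : (U K g)⟦X⟧) : comulId (inr a) = inThd a := by
  ext n; simp [comulId, inr, inThd]

theorem idComul_inl (a : (U K g)⟦X⟧) : idComul (inl a) = inFst a := by
  ext n; simp [idComul, inl, inFst, leg12, Algebra.TensorProduct.one_def]

theorem idComul_inr (a : (U K g)⟦X⟧) : idComul (inr a) = leg23 (hComul a) := by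
  ext n; simp [idComul, inr, leg23, hComul]

theorem counitId_inl (a : (U K g)⟦X⟧) : counitId (inl a) = hCounit a := by
  ext n; simp [counitId, inl, hCounit, Algebra.ofId_apply, Algebra.algebraMap_eq_smul_one]

theorem idCounit_inr (a : (U K g)⟦X⟧) : idCounit (inr a) = hCounit a := by
  ext n; simp [idCounit, inr, hCounit, Algebra.ofId_apply, Algebra.algebraMap_eq_smul_one]

theorem commute_leg12_inThd (t : (U K g ⊗[K] U K g)⟦X⟧) (a : (U K g)⟦X⟧) :
    Commute (leg12 t) (inThd a) :=
  commute_map_map (fun x y => by simp [Commute, SemiconjBy]) t a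

theorem commute_inFst_leg23 (a : (U K g)⟦X⟧) (t : (U K g ⊗[K] U K g)⟦X⟧) :
    Commute (inFst a) (leg23 t) := by
  -- `leg23` is defined through the associator, so the first leg is rewritten the same way; the
  -- commutation then takes place in U ⊗ (U ⊗ U), where it is evident.
  have h : inFst a = PowerSeries.map
      ((Algebra.TensorProduct.assoc K K K (U K g) (U K g) (U K g)).symm.toAlgHom.comp
        (Algebra.TensorProduct.includeLeft :
          U K g →ₐ[K] U K g ⊗[K] (U K g ⊗[K] U K g))).toRingHom a := by
    ext n; simp [inl, inFst, leg12, Algebra.TensorProduct.one_def]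
  rw [h]
  refine commute_map_map (fun x y => ?_) a t
  simp only [AlgHom.toRingHom_eq_coe, RingHom.coe_coe, AlgHom.comp_apply]
  refine Commute.map
    (f := (Algebra.TensorProduct.assoc K K K (U K g) (U K g) (U K g)).symm.toAlgHom)
    ?_
  simp [Commute, SemiconjBy]

theorem commute_inFst_inSnd (a b : (U K g)⟦X⟧) : Commute (inFst a) (inSnd b) :=
  (commute_inl_inr a b).map leg12

theorem commute_inFst_inThd (a b : (U K g)⟦X⟧) : Commute (inFst a) (inThd b) :=
  commute_leg12_inThd _ b

theorem commute_inSnd_inThd (a b : (U K g)⟦X⟧) : Commute (inSnd a) (inThd b) :=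
  commute_leg12_inThd _ b

@[simp] theorem inl_X : inl (X : (U K g)⟦X⟧) = X := PowerSeries.map_X _
@[simp] theorem inr_X : inr (X : (U K g)⟦X⟧) = X := PowerSeries.map_X _
@[simp] theorem hComul_X : hComul (X : (U K g)⟦X⟧) = X := PowerSeries.map_X _
@[simp] theorem leg12_X : leg12 (X : (U K g ⊗[K] U K g)⟦X⟧) = X := PowerSeries.map_X _
@[simp] theorem leg23_X : leg23 (X : (U K g ⊗[K] U K g)⟦X⟧) = X := PowerSeries.map_X _
@[simp] theorem comulId_X : comulId (X : (U K g ⊗[K] U K g)⟦X⟧) = X := PowerSeries.map_X _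
@[simp] theorem idComul_X : idComul (X : (U K g ⊗[K] U K g)⟦X⟧) = X := PowerSeries.map_X _

theorem hComul_emb (x : g) : hComul (emb x : (U K g)⟦X⟧) = inl (emb x) + inr (emb x) := by
  simp [hComul, emb, inl, inr, comul, PowerSeries.map_C, UniversalEnvelopingAlgebra.lift_ι_apply']

theorem hCounit_emb (x : g) : hCounit (emb x : (U K g)⟦X⟧) = 0 := by
  simp [hCounit, emb, counit, PowerSeries.map_C, UniversalEnvelopingAlgebra.lift_ι_apply']

theorem hComul_smul (c : K) (a : (U K g)⟦X⟧) : hComul (c • a) = c • hComul a := by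
  ext n; simp [hComul]

theorem inl_smul (c : K) (a : (U K g)⟦X⟧) : inl (c • a) = c • inl a := by
  ext n; simp [inl]

theorem inr_smul (c : K) (a : (U K g)⟦X⟧) : inr (c • a) = c • inr a := by
  ext n; simp [inr]

theorem constantCoeff_inl {a : (U K g)⟦X⟧} (ha : constantCoeff a = 0) :
    constantCoeff (inl a) = 0 := by
  rw [← coeff_zero_eq_constantCoeff_apply] at ha ⊢; rw [inl, coeff_map, ha, map_zero]

theorem constantCoeff_inr {a : (U K g)⟦X⟧} (ha : constantCoeff a = 0) :
    constantCoeff (inr a) = 0 := by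
  rw [← coeff_zero_eq_constantCoeff_apply] at ha ⊢; rw [inr, coeff_map, ha, map_zero]

theorem constantCoeff_inSnd {a : (U K g)⟦X⟧} (ha : constantCoeff a = 0) :
    constantCoeff (inSnd a) = 0 := by
  have := constantCoeff_inr ha
  rw [← coeff_zero_eq_constantCoeff_apply] at this ⊢
  rw [inSnd, RingHom.comp_apply, leg12, coeff_map, this, map_zero]

theorem constantCoeff_inThd {a : (U K g)⟦X⟧} (ha : constantCoeff a = 0) :
    constantCoeff (inThd a) = 0 := by
  rw [← coeff_zero_eq_constantCoeff_apply] at ha ⊢; rw [inThd, coeff_map, ha, map_zero]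

theorem constantCoeff_hComul {a : (U K g)⟦X⟧} (ha : constantCoeff a = 0) :
    constantCoeff (hComul a) = 0 := by
  rw [← coeff_zero_eq_constantCoeff_apply] at ha ⊢; rw [hComul, coeff_map, ha, map_zero]

/-- Twisted coproducts are handled below as relations `SemiconjBy F (hComul a) t`, which involve no
inverse and compose along products of factors. -/
theorem isPrimitiveFor_iff {F : (U K g ⊗[K] U K g)⟦X⟧} (hF : IsUnit F) (a : (U K g)⟦X⟧) :
    IsPrimitiveFor F a ↔ SemiconjBy F (hComul a) (inl a + inr a) := by
  obtain ⟨u, rfl⟩ := hF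
  rw [IsPrimitiveFor, twistedComul, Ring.inverse_unit, tens_eq, tens_eq, map_one, map_one, mul_one,
    one_mul, Units.mul_inv_eq_iff_eq_mul, SemiconjBy]

theorem isTwist_one : IsTwist (1 : (U K g ⊗[K] U K g)⟦X⟧) where
  isUnit := isUnit_one
  constantCoeff_eq_one := map_one _
  cocycle := by simp only [map_one]
  counit_left := map_one _
  counit_right := map_one _

/-- A twist of a twist: the cocycle equation of `G * F` reduces to an equation for `G` in the
algebra twisted by `F`. -/
theorem IsTwist.mul_left {F G : (U K g ⊗[K] U K g)⟦X⟧} (hF : IsTwist F) (hG : IsUnit G)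
    (hG1 : constantCoeff G = 1) {S T : ((U K g ⊗[K] U K g) ⊗[K] U K g)⟦X⟧}
    (hS : SemiconjBy (leg12 F) (comulId G) S) (hT : SemiconjBy (leg23 (G * F)) (idComul G) T)
    (hST : leg12 G * S = T * leg23 G) (hGl : counitId G = 1) (hGr : idCounit G = 1) :
    IsTwist (G * F) where
  isUnit := hG.mul hF.isUnit
  constantCoeff_eq_one := by rw [map_mul, hG1, hF.constantCoeff_eq_one, mul_one]
  cocycle := by
    calc leg12 (G * F) * comulId (G * F)
        = leg12 G * (leg12 F * comulId G) * comulId F := by simp only [map_mul, mul_assoc]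
      _ = leg12 G * S * (leg12 F * comulId F) := by simp only [hS.eq, mul_assoc]
      _ = T * leg23 G * (leg23 F * idComul F) := by rw [hST, hF.cocycle]
      _ = leg23 (G * F) * idComul G * idComul F := by rw [hT.eq, map_mul]; simp only [mul_assoc]
      _ = leg23 (G * F) * idComul (G * F) := by rw [map_mul (idComul (K := K) (g := g)), mul_assoc]
  counit_left := by rw [map_mul, hGl, hF.counit_left, mul_one]
  counit_right := by rw [map_mul, hGr, hF.counit_right, mul_one]

/-- Together with `semiconjBy_leg23_idComul`, this supplies the S and T of `IsTwist.mul_left` from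
the twisted coproduct of a single leg. -/
theorem semiconjBy_leg12_comulId {F t : (U K g ⊗[K] U K g)⟦X⟧} {a : (U K g)⟦X⟧}
    (h : SemiconjBy F (hComul a) t) (b : (U K g)⟦X⟧) :
    SemiconjBy (leg12 F) (comulId (inl a * inr b)) (leg12 t * inThd b) := by
  rw [map_mul, comulId_inl, comulId_inr]
  exact (h.map leg12).mul_right (commute_leg12_inThd F b)

theorem semiconjBy_leg23_idComul {F t : (U K g ⊗[K] U K g)⟦X⟧} {b : (U K g)⟦X⟧}
    (h : SemiconjBy F (hComul b) t) (a : (U K g)⟦X⟧) :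
    SemiconjBy (leg23 F) (idComul (inl a * inr b)) (inFst a * leg23 t) := by
  rw [map_mul, idComul_inl, idComul_inr]
  exact SemiconjBy.mul_right (commute_inFst_leg23 a F).symm (h.map leg23)

end Legs

/-! ### The Jordanian and the extension factor over an arbitrary twist. -/

section Exp

variable {K g : Type*} [Field K] [CharZero K] [LieRing g] [LieAlgebra K g]

theorem inl_hExp (a : (U K g)⟦X⟧) : inl (hExp K a) = hExp K (inl a) := map_hExp _ a
theorem inr_hExp (a : (U K g)⟦X⟧) : inr (hExp K a) = hExp K (inr a) := map_hExp _ a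
theorem hComul_hExp (a : (U K g)⟦X⟧) : hComul (hExp K a) = hExp K (hComul a) := map_hExp _ a
theorem leg12_hExp (a : (U K g ⊗[K] U K g)⟦X⟧) : leg12 (hExp K a) = hExp K (leg12 a) :=
  map_hExp _ a
theorem leg23_hExp (a : (U K g ⊗[K] U K g)⟦X⟧) : leg23 (hExp K a) = hExp K (leg23 a) :=
  map_hExp _ a
theorem comulId_hExp (a : (U K g ⊗[K] U K g)⟦X⟧) : comulId (hExp K a) = hExp K (comulId a) :=
  map_hExp _ a
theorem idComul_hExp (a : (U K g ⊗[K] U K g)⟦X⟧) : idComul (hExp K a) = hExp K (idComul a) :=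
  map_hExp _ a
theorem counitId_hExp (a : (U K g ⊗[K] U K g)⟦X⟧) : counitId (hExp K a) = hExp K (counitId a) :=
  map_hExp _ a
theorem idCounit_hExp (a : (U K g ⊗[K] U K g)⟦X⟧) : idCounit (hExp K a) = hExp K (idCounit a) :=
  map_hExp _ a
theorem inl_hLogOneAdd (a : (U K g)⟦X⟧) : inl (hLogOneAdd K a) = hLogOneAdd K (inl a) :=
  map_hLogOneAdd _ a
theorem inr_hLogOneAdd (a : (U K g)⟦X⟧) : inr (hLogOneAdd K a) = hLogOneAdd K (inr a) :=
  map_hLogOneAdd _ a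
theorem hComul_hLogOneAdd (a : (U K g)⟦X⟧) : hComul (hLogOneAdd K a) = hLogOneAdd K (hComul a) :=
  map_hLogOneAdd _ a
theorem hCounit_hLogOneAdd (a : (U K g)⟦X⟧) :
    hCounit (hLogOneAdd K a) = hLogOneAdd K (hCounit a) := map_hLogOneAdd _ a

theorem constantCoeff_X_mul {A : Type*} [Ring A] (a : A⟦X⟧) : constantCoeff (X * a) = 0 := by
  simp

section Jordanian

variable {F : (U K g ⊗[K] U K g)⟦X⟧} {H y : (U K g)⟦X⟧}

/-- The logarithm `ln (1 + ħ y)` is primitive after the Jordanian twist by `H`, `y`. -/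
theorem semiconjBy_hComul_hLogOneAdd (hy : SemiconjBy F (hComul y) (inl y + inr y))
    (hHy : H * y = y * H + y) :
    SemiconjBy (hExp K (tens H (hLogOneAdd K (X * y))) * F) (hComul (hLogOneAdd K (X * y)))
      (inl (hLogOneAdd K (X * y)) + inr (hLogOneAdd K (X * y))) := by
  set s := hLogOneAdd K (X * y) with hs
  have hs0 : constantCoeff s = 0 := constantCoeff_hLogOneAdd _
  have ha0 : constantCoeff (inl H * inr s) = 0 := by rw [map_mul, constantCoeff_inr hs0, mul_zero]
  have hsy : Commute s y :=
    (commute_evalSeries ((commute_X y).mul_right (Commute.refl y)) (constantCoeff_X_mul y) _).symm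
  -- From Hy = y(H+1), moving H⊗s past y⊗1 adds 1⊗s; conjugation therefore multiplies y⊗1 by 1⊗eˢ =
  -- 1⊗(1+ħy).
  have hl : SemiconjBy (hExp K (inl H * inr s)) (inl y) (inl y * (1 + X * inr y)) := by
    have h1 : hExp K (inr s) = 1 + X * inr y := by
      rw [← inr_hExp, hs, hExp_hLogOneAdd (constantCoeff_X_mul y), map_add, map_one, map_mul, inr_X]
    rw [← h1]
    refine semiconjBy_hExp_of_shift ha0 (constantCoeff_inr hs0) ?_
      ((commute_inl_inr H s).mul_left (Commute.refl _))
    rw [mul_assoc, ← (commute_inl_inr y s).eq, ← mul_assoc, ← map_mul, hHy, map_add, map_mul,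
      mul_add, add_mul, mul_assoc]
  have hr : Commute (hExp K (inl H * inr s)) (inr y) := by
    refine (commute_evalSeries (K := K) (Commute.mul_right (commute_inl_inr H y).symm ?_)
      ha0 _).symm
    exact hsy.symm.map inr
  -- This says that 1+ħy has become group-like.
  have hX : SemiconjBy (hExp K (inl H * inr s) * F) (hComul (X * y))
      (inl (X * y) + inr (X * y) + inl (X * y) * inr (X * y)) := by
    rw [map_mul, hComul_X]
    have h2 : SemiconjBy (hExp K (inl H * inr s) * F) (hComul y)
        (inl y * (1 + X * inr y) + inr y) := SemiconjBy.mul_left (hl.add_right hr) hy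
    have h3 := SemiconjBy.mul_right (commute_X (hExp K (inl H * inr s) * F)) h2
    have e : inl (X * y) + inr (X * y) + inl (X * y) * inr (X * y) =
        X * (inl y * (1 + X * inr y) + inr y) := by
      rw [map_mul, map_mul, inl_X, inr_X, mul_X_mul]
      simp only [mul_add, mul_one, mul_assoc, mul_X_mul (inl y)]
      abel
    rw [e]
    exact h3
  rw [hs, hComul_hLogOneAdd, inl_hLogOneAdd, inr_hLogOneAdd,
    ← hLogOneAdd_add_add_mul (commute_inl_inr _ _)
      (constantCoeff_inl (constantCoeff_X_mul y)) (constantCoeff_inr (constantCoeff_X_mul y))]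
  have h3 := constantCoeff_inl (constantCoeff_X_mul y)
  have h4 := constantCoeff_inr (constantCoeff_X_mul y)
  exact semiconjBy_hLogOneAdd hX (constantCoeff_hComul (constantCoeff_X_mul y))
    (by rw [map_add, map_add, map_mul (constantCoeff), h3, h4]; simp)

/-- The Jordanian twist on a Borel subalgebra of primitive elements of a twisted algebra. -/
theorem IsTwist.jordanian (hF : IsTwist F) (hH : SemiconjBy F (hComul H) (inl H + inr H))
    (hy : SemiconjBy F (hComul y) (inl y + inr y)) (hHy : H * y = y * H + y)
    (hH0 : hCounit H = 0) (hy0 : hCounit y = 0) :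
    IsTwist (hExp K (tens H (hLogOneAdd K (X * y))) * F) := by
  have hprim := semiconjBy_hComul_hLogOneAdd (K := K) hy hHy
  set s := hLogOneAdd K (X * y) with hs
  have hs0 : constantCoeff s = 0 := constantCoeff_hLogOneAdd _
  have hr0 := constantCoeff_inr hs0
  have h20 := constantCoeff_inSnd hs0
  have h30 := constantCoeff_inThd hs0
  have ha0 : constantCoeff (inl H * inr s) = 0 := by rw [map_mul, hr0, mul_zero]
  rw [tens_eq] at hprim ⊢
  have hS := semiconjBy_leg12_comulId hH s
  have hT := semiconjBy_leg23_idComul hprim H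
  have e1 : comulId (inl H * inr s) = leg12 (hComul H) * inThd s := by
    rw [map_mul, comulId_inl, comulId_inr]
  have e2 : idComul (inl H * inr s) = inFst H * leg23 (hComul s) := by
    rw [map_mul, idComul_inl, idComul_inr]
  have c23 : constantCoeff (leg23 (hComul s)) = 0 := by
    have := constantCoeff_hComul hs0
    rw [← coeff_zero_eq_constantCoeff_apply] at this ⊢
    rw [leg23, coeff_map, this, map_zero]
  refine hF.mul_left (isUnit_hExp ha0) (constantCoeff_hExp _)
    (S := hExp K (leg12 (inl H + inr H) * inThd s))
    (T := hExp K (inFst H * leg23 (inl s + inr s))) ?_ ?_ ?_ ?_ ?_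
  · rw [comulId_hExp]
    refine semiconjBy_hExp hS ?_ ?_
    · rw [e1, map_mul, h30, mul_zero]
    · rw [map_mul, h30, mul_zero]
  · rw [idComul_hExp]
    refine semiconjBy_hExp hT ?_ ?_
    · rw [e2, map_mul, c23, mul_zero]
    · rw [map_mul, map_add, leg23_inl, leg23_inr, map_add, h20, h30, add_zero, mul_zero]
  -- Both sides are exp(H⊗s⊗1) exp(H⊗1⊗s) exp(1⊗H⊗s): the sums inside S and T split because their
  -- two summands commute.
  · simp only [leg12_hExp, leg23_hExp, map_mul, map_add, leg12_inl, leg12_inr, leg23_inl,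
      leg23_inr, add_mul, mul_add]
    rw [hExp_add, hExp_add, mul_assoc]
    · refine Commute.mul_left ?_ ?_
      · exact (Commute.refl _).mul_right (commute_inFst_inThd H s)
      · exact (commute_inFst_inSnd H s).symm.mul_right (commute_inSnd_inThd s s)
    · rw [map_mul, h20, mul_zero]
    · rw [map_mul, h30, mul_zero]
    · refine Commute.mul_left ?_ ?_
      · exact (commute_inFst_inSnd H H).mul_right (commute_inFst_inThd H s)
      · exact (commute_inSnd_inThd H s).symm.mul_right (Commute.refl _)
    · rw [map_mul, h30, mul_zero]
    · rw [map_mul, h30, mul_zero]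
  · rw [counitId_hExp, map_mul, counitId_inl, hH0, zero_mul, hExp_zero]
  · rw [idCounit_hExp, map_mul, idCounit_inr, hs, hCounit_hLogOneAdd, map_mul, hy0, mul_zero,
      hLogOneAdd_zero, mul_zero, hExp_zero]

end Jordanian

section Extension

variable {F : (U K g ⊗[K] U K g)⟦X⟧} {A B q q' R : (U K g)⟦X⟧}

/-- The coproduct of the second element of an extension pair, after the extension. -/
theorem semiconjBy_extension (hB : SemiconjBy F (hComul B) (inl B + inl q' * inr B))
    (hAB : A * B = B * A + R) (hAR : Commute A R) (hR : X * R + q' = q) (hAq' : Commute A q') :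
    SemiconjBy (hExp K (X * tens A B) * F) (hComul B) (inl B + inl q * inr B) := by
  rw [tens_eq]
  refine SemiconjBy.mul_left ?_ hB
  -- Conjugating B⊗1 produces the extra term ħR⊗B, which raises the coefficient q' in q'⊗B to q.
  have h1 : SemiconjBy (hExp K (X * (inl A * inr B))) (inl B) (inl B + X * inl R * inr B) := by
    refine semiconjBy_hExp_of_commutator (constantCoeff_X_mul _) ?_ ?_
    · rw [mul_X_mul, mul_assoc, mul_assoc (inl A), ← (commute_inl_inr B B).eq,
        ← mul_assoc (inl A), ← map_mul, hAB, map_add, map_mul, add_mul, mul_add, mul_assoc X,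
        mul_assoc (inl B)]
    · rw [mul_assoc]
      refine commute_X_mul_X_mul ?_
      exact ((hAR.map inl).mul_right (commute_inl_inr A B)).mul_left
        ((commute_inl_inr R B).symm.mul_right (Commute.refl _))
  have h2 : Commute (hExp K (X * (inl A * inr B))) (inl q' * inr B) := by
    refine (commute_evalSeries (K := K) ?_ (constantCoeff_X_mul _) _).symm
    refine (commute_X _).mul_right (Commute.mul_right ?_ ?_)
    · exact (hAq'.map inl).symm.mul_left (commute_inl_inr A B).symm
    · exact (commute_inl_inr q' B).mul_left (Commute.refl _)
  rw [← hR, map_add, map_mul, inl_X, add_mul, ← add_assoc]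
  exact h1.add_right h2

/-- Extension of a twist by a pair `A`, `B` of elements with commutator `R` and quasi-primitive
coproducts. -/
theorem IsTwist.extension (hF : IsTwist F)
    (hA : SemiconjBy F (hComul A) (inl A * inr q + inr A))
    (hB : SemiconjBy F (hComul B) (inl B + inl q' * inr B))
    (hAB : A * B = B * A + R) (hAR : Commute A R) (hR : X * R + q' = q)
    (hAq : Commute A q) (hAq' : Commute A q') (hBq : Commute B q)
    (hA0 : hCounit A = 0) (hB0 : hCounit B = 0) :
    IsTwist (hExp K (X * tens A B) * F) := by
  rw [tens_eq]
  have hG : SemiconjBy (hExp K (X * (inl A * inr B)) * F) (hComul B) (inl B + inl q * inr B) :=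
    semiconjBy_extension hB hAB hAR hR hAq'
  have hS := semiconjBy_leg12_comulId hA B
  have hT := semiconjBy_leg23_idComul hG A
  refine hF.mul_left (isUnit_hExp (constantCoeff_X_mul _)) (constantCoeff_hExp _)
    (S := hExp K (X * (leg12 (inl A * inr q + inr A) * inThd B)))
    (T := hExp K (X * (inFst A * leg23 (inl B + inl q * inr B)))) ?_ ?_ ?_ ?_ ?_
  · rw [comulId_hExp, map_mul, comulId_X]
    exact semiconjBy_hExp (SemiconjBy.mul_right (commute_X _) hS) (constantCoeff_X_mul _)
      (constantCoeff_X_mul _)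
  · rw [idComul_hExp, map_mul (idComul (K := K) (g := g)), idComul_X]
    exact semiconjBy_hExp (SemiconjBy.mul_right (commute_X _) hT) (constantCoeff_X_mul _)
      (constantCoeff_X_mul _)
  -- Both sides are the product, in this order, of the exponentials of ħA⊗B⊗1, ħA⊗q⊗B and ħ1⊗A⊗B. S
  -- takes q from the coproduct of A before the extension, T from that of B after it.
  · simp only [leg12_hExp, leg23_hExp, map_mul, map_add, leg12_inl, leg12_inr, leg12_X, leg23_X,
      leg23_inl, leg23_inr, add_mul, mul_add]
    rw [mul_assoc (inFst A), hExp_add, hExp_add, mul_assoc]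
    · refine commute_X_mul_X_mul (Commute.mul_left ?_ ?_)
      · exact (Commute.refl _).mul_right
          ((commute_inFst_inSnd A q).mul_right (commute_inFst_inThd A B))
      · exact (commute_inFst_inSnd A B).symm.mul_right
          ((hBq.map inSnd).mul_right (commute_inSnd_inThd B B))
    · exact constantCoeff_X_mul _
    · exact constantCoeff_X_mul _
    · refine commute_X_mul_X_mul (Commute.mul_left ?_ (Commute.mul_left ?_ ?_))
      · exact (commute_inFst_inSnd A A).mul_right (commute_inFst_inThd A B)
      · exact (hAq.map inSnd).symm.mul_right (commute_inSnd_inThd q B)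
      · exact (commute_inSnd_inThd A B).symm.mul_right (Commute.refl _)
    · exact constantCoeff_X_mul _
    · exact constantCoeff_X_mul _
  · rw [counitId_hExp, map_mul, map_mul, counitId_inl, hA0, zero_mul, mul_zero, hExp_zero]
  · rw [idCounit_hExp, map_mul, map_mul, idCounit_inr, hB0, mul_zero, mul_zero, hExp_zero]

end Extension

end Exp

end JordanianTwist

/-! ### Brackets of the carrier and the action of the concrete factors on root vectors. -/

namespace JordanianTwist

open PowerSeries

/-- The brackets of the basis of the carrier algebra. -/
structure CarrierRelations (K : Type*) {g : Type*} [Field K] [LieRing g] [LieAlgebra K g]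
    (H Hp E P A₁ B₁ A₂ B₂ : g) : Prop where
  H_Hp : ⁅H, Hp⁆ = 0
  H_E : ⁅H, E⁆ = E
  H_P : ⁅H, P⁆ = 0
  H_A₁ : ⁅H, A₁⁆ = -((2 : K)⁻¹ • A₁)
  H_B₁ : ⁅H, B₁⁆ = (2 : K)⁻¹ • B₁
  H_A₂ : ⁅H, A₂⁆ = -((2 : K)⁻¹ • A₂)
  H_B₂ : ⁅H, B₂⁆ = (2 : K)⁻¹ • B₂
  Hp_E : ⁅Hp, E⁆ = 0
  Hp_P : ⁅Hp, P⁆ = P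
  Hp_A₁ : ⁅Hp, A₁⁆ = (2 : K)⁻¹ • A₁
  Hp_B₁ : ⁅Hp, B₁⁆ = (2 : K)⁻¹ • B₁
  Hp_A₂ : ⁅Hp, A₂⁆ = (2 : K)⁻¹ • A₂
  Hp_B₂ : ⁅Hp, B₂⁆ = (2 : K)⁻¹ • B₂
  E_P : ⁅E, P⁆ = 0
  A₁_E : ⁅A₁, E⁆ = -B₂
  E_B₁ : ⁅E, B₁⁆ = 0
  A₂_E : ⁅A₂, E⁆ = -B₁
  E_B₂ : ⁅E, B₂⁆ = 0
  P_A₁ : ⁅P, A₁⁆ = 0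
  P_B₁ : ⁅P, B₁⁆ = 0
  P_A₂ : ⁅P, A₂⁆ = 0
  P_B₂ : ⁅P, B₂⁆ = 0
  A₁_B₁ : ⁅A₁, B₁⁆ = P
  A₁_A₂ : ⁅A₁, A₂⁆ = 0
  A₁_B₂ : ⁅A₁, B₂⁆ = 0
  A₂_B₁ : ⁅A₂, B₁⁆ = 0
  B₁_B₂ : ⁅B₁, B₂⁆ = 0
  A₂_B₂ : ⁅A₂, B₂⁆ = P

section Emb

variable {K g : Type*} [Field K] [LieRing g] [LieAlgebra K g]

attribute [local instance 100] LieRing.ofAssociativeRing in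
theorem emb_mul_emb (x y : g) :
    (emb x * emb y : (U K g)⟦X⟧) = emb y * emb x + emb ⁅x, y⁆ := by
  simp only [emb, LieHom.map_lie, LieRing.of_associative_ring_bracket, map_sub, map_mul]
  abel

theorem commute_emb {x y : g} (h : ⁅x, y⁆ = 0) : Commute (emb x : (U K g)⟦X⟧) (emb y) := by
  have := emb_mul_emb (K := K) x y
  rwa [h, emb, emb, emb, map_zero, map_zero, add_zero] at this

theorem emb_smul (c : K) (x : g) : (emb (c • x) : (U K g)⟦X⟧) = c • emb x := by
  ext n
  change coeff n (emb (c • x) : (U K g)⟦X⟧) = c • coeff n (emb x : (U K g)⟦X⟧)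
  rw [emb, emb, coeff_C, coeff_C, map_smul]
  split_ifs <;> simp

theorem emb_neg (x : g) : (emb (-x) : (U K g)⟦X⟧) = -emb x := by
  simp [emb]

theorem constantCoeff_smul_eq_zero {A : Type*} [Ring A] [Algebra K A] {a : A⟦X⟧}
    (ha : constantCoeff a = 0) (c : K) : constantCoeff (c • a) = 0 := by
  change c • constantCoeff a = 0
  rw [ha, smul_zero]

end Emb

variable {K g : Type*} [Field K] [CharZero K] [LieRing g] [LieAlgebra K g]

section Half

/-- `e^{σ/2}`, with `σ = ln (1 + ħ x)`. -/
noncomputable def expHalf (x : g) : (U K g)⟦X⟧ := hExp K ((2 : K)⁻¹ • sigma x)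

/-- `e^{-σ/2}`, with `σ = ln (1 + ħ x)`. -/
noncomputable def expNegHalf (x : g) : (U K g)⟦X⟧ := hExp K (-((2 : K)⁻¹ • sigma x))

theorem constantCoeff_sigma (x : g) : constantCoeff (sigma x : (U K g)⟦X⟧) = 0 :=
  constantCoeff_hLogOneAdd _

theorem constantCoeff_half_sigma (x : g) :
    constantCoeff ((2 : K)⁻¹ • sigma x : (U K g)⟦X⟧) = 0 :=
  constantCoeff_smul_eq_zero (constantCoeff_sigma x) _

theorem constantCoeff_neg_half_sigma (x : g) :
    constantCoeff (-((2 : K)⁻¹ • sigma x) : (U K g)⟦X⟧) = 0 := by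
  rw [map_neg, constantCoeff_half_sigma, neg_zero]

theorem half_add_half {M : Type*} [AddCommGroup M] [Module K M] (m : M) :
    (2 : K)⁻¹ • m + (2 : K)⁻¹ • m = m := by
  rw [← add_smul, ← two_mul, mul_inv_cancel₀ two_ne_zero, one_smul]

theorem expHalf_mul_expNegHalf (x : g) : (expHalf x * expNegHalf x : (U K g)⟦X⟧) = 1 :=
  hExp_mul_hExp_neg (constantCoeff_half_sigma x)

theorem expNegHalf_mul_expHalf (x : g) : (expNegHalf x * expHalf x : (U K g)⟦X⟧) = 1 :=
  hExp_neg_mul_hExp (constantCoeff_half_sigma x)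

theorem expHalf_mul_expHalf (x : g) :
    (expHalf x * expHalf x : (U K g)⟦X⟧) = 1 + X * emb x := by
  rw [expHalf, ← hExp_add (Commute.refl _) (constantCoeff_half_sigma x)
    (constantCoeff_half_sigma x), half_add_half, sigma, hExp_hLogOneAdd (constantCoeff_X_mul _)]

theorem expNegHalf_mul_expNegHalf (x : g) :
    (expNegHalf x * expNegHalf x : (U K g)⟦X⟧) = hExp K (-sigma x) := by
  rw [expNegHalf, ← hExp_add (Commute.refl _) (constantCoeff_neg_half_sigma x)
    (constantCoeff_neg_half_sigma x), ← neg_add, half_add_half]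

/-- This is the condition ħR + q' = q of the extension criterion: (1+ħx)e^{-σ/2} = e^{σ/2}. -/
theorem X_mul_emb_mul_expNegHalf_add (x : g) :
    (X * (emb x * expNegHalf x) + expNegHalf x : (U K g)⟦X⟧) = expHalf x := by
  have h : (X * (emb x * expNegHalf x) + expNegHalf x : (U K g)⟦X⟧) =
      (1 + X * emb x) * expNegHalf x := by
    rw [add_mul, one_mul, mul_assoc, add_comm]
  rw [h, ← expHalf_mul_expHalf, mul_assoc, expHalf_mul_expNegHalf, mul_one]

variable {x : g} {c : (U K g)⟦X⟧}

theorem commute_sigma (h : Commute c (emb x)) : Commute c (sigma x) :=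
  commute_evalSeries ((commute_X c).mul_right h) (constantCoeff_X_mul _) _

theorem commute_expHalf (h : Commute c (emb x)) : Commute c (expHalf x) :=
  commute_evalSeries ((commute_sigma h).smul_right _) (constantCoeff_half_sigma x) _

theorem commute_expNegHalf (h : Commute c (emb x)) : Commute c (expNegHalf x) :=
  commute_evalSeries ((commute_sigma h).smul_right _).neg_right (constantCoeff_neg_half_sigma x) _

theorem semiconjBy_hComul_expHalf {F : (U K g ⊗[K] U K g)⟦X⟧}
    (h : SemiconjBy F (hComul (sigma x)) (inl (sigma x) + inr (sigma x))) :
    SemiconjBy F (hComul (expHalf x)) (inl (expHalf x) * inr (expHalf x)) := by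
  have h0 := constantCoeff_half_sigma (K := K) x
  rw [expHalf, hComul_hExp, inl_hExp, inr_hExp, ← hExp_add (commute_inl_inr _ _)
    (constantCoeff_inl h0) (constantCoeff_inr h0), hComul_smul, inl_smul, inr_smul, ← smul_add]
  refine semiconjBy_hExp ?_ (constantCoeff_smul_eq_zero (constantCoeff_hComul
    (constantCoeff_sigma x)) _) (constantCoeff_smul_eq_zero ?_ _)
  · rw [SemiconjBy, mul_smul_comm, smul_mul_assoc, h.eq]
  · rw [map_add, constantCoeff_inl (constantCoeff_sigma x),
      constantCoeff_inr (constantCoeff_sigma x), add_zero]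

/-- The inverse of a group-like element is group-like. -/
theorem semiconjBy_hComul_expNegHalf {F : (U K g ⊗[K] U K g)⟦X⟧}
    (h : SemiconjBy F (hComul (sigma x)) (inl (sigma x) + inr (sigma x))) :
    SemiconjBy F (hComul (expNegHalf x)) (inl (expNegHalf x) * inr (expNegHalf x)) := by
  have h1 := (semiconjBy_hComul_expHalf h).eq
  have h2 : hComul (expHalf x) * hComul (expNegHalf x) = (1 : (U K g ⊗[K] U K g)⟦X⟧) := by
    rw [← map_mul, expHalf_mul_expNegHalf, map_one]
  have h3 : inl (expNegHalf x) * inr (expNegHalf x) * (inl (expHalf x) * inr (expHalf x)) =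
      (1 : (U K g ⊗[K] U K g)⟦X⟧) := by
    rw [mul_assoc, ← mul_assoc (inr _), ← (commute_inl_inr _ _).eq, mul_assoc, ← mul_assoc,
      ← map_mul, ← map_mul, expNegHalf_mul_expHalf, map_one, map_one, one_mul]
  calc F * hComul (expNegHalf x)
      = inl (expNegHalf x) * inr (expNegHalf x) * (inl (expHalf x) * inr (expHalf x) * F) *
          hComul (expNegHalf x) := by rw [← mul_assoc _ _ F, h3, one_mul]
    _ = _ := by rw [← h1, mul_assoc _ (F * _), mul_assoc F, h2, mul_one]

end Half

section Jordanian

variable {Hp P x : g}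

theorem jordanianFactor_eq (H : g) (y : (U K g)⟦X⟧) :
    jordanianFactor H y = hExp K (inl (emb H) * inr (hLogOneAdd K (X * y))) := rfl

theorem isTwist_jordanianFactor (h : ⁅Hp, P⁆ = P) :
    IsTwist (jordanianFactor (K := K) Hp (emb P)) := by
  have h1 := isTwist_one (K := K) (g := g) |>.jordanian (H := emb Hp) (y := emb P)
    (by rw [hComul_emb]; exact SemiconjBy.one_left _)
    (by rw [hComul_emb]; exact SemiconjBy.one_left _)
    (by rw [emb_mul_emb, h]) (hCounit_emb _) (hCounit_emb _)
  rwa [mul_one] at h1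

theorem semiconjBy_jordanianFactor_sigma (h : ⁅Hp, P⁆ = P) :
    SemiconjBy (jordanianFactor (K := K) Hp (emb P)) (hComul (sigma P))
      (inl (sigma P) + inr (sigma P)) := by
  have h1 := semiconjBy_hComul_hLogOneAdd (K := K) (F := 1) (H := emb Hp) (y := emb P)
    (by rw [hComul_emb]; exact SemiconjBy.one_left _) (by rw [emb_mul_emb, h])
  rwa [mul_one] at h1

theorem constantCoeff_inl_mul_inr_sigma (a : (U K g)⟦X⟧) (x : g) :
    constantCoeff (inl a * inr (sigma x)) = 0 := by
  rw [map_mul, constantCoeff_inr (constantCoeff_sigma x), mul_zero]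

theorem commute_jordanianFactor_inr (hx : ⁅x, P⁆ = 0) :
    Commute (jordanianFactor (K := K) Hp (emb P)) (inr (emb x)) := by
  rw [jordanianFactor_eq]
  refine (commute_evalSeries (K := K) ((commute_inl_inr _ _).symm.mul_right ?_)
    (constantCoeff_inl_mul_inr_sigma _ P) _).symm
  exact (commute_sigma (commute_emb hx)).map inr

theorem commute_jordanianFactor_inl (hx : ⁅x, Hp⁆ = 0) :
    Commute (jordanianFactor (K := K) Hp (emb P)) (inl (emb x)) := by
  rw [jordanianFactor_eq]
  exact (commute_evalSeries (K := K) (((commute_emb hx).map inl).mul_right (commute_inl_inr _ _))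
    (constantCoeff_inl_mul_inr_sigma _ P) _).symm

theorem semiconjBy_jordanianFactor_of_commute (hx : ⁅x, Hp⁆ = 0) (hP : ⁅x, P⁆ = 0) :
    SemiconjBy (jordanianFactor (K := K) Hp (emb P)) (hComul (emb x))
      (inl (emb x) + inr (emb x)) := by
  rw [hComul_emb]
  exact SemiconjBy.add_right (commute_jordanianFactor_inl hx) (commute_jordanianFactor_inr hP)

/-- Weight 1/2 under H_⊥ makes the conjugated left leg acquire exp of half of σ on the right; this
is the source of q = e^{σ/2}. -/
theorem semiconjBy_jordanianFactor_of_half (hx : ⁅Hp, x⁆ = (2 : K)⁻¹ • x) (hP : ⁅x, P⁆ = 0) :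
    SemiconjBy (jordanianFactor (K := K) Hp (emb P)) (hComul (emb x))
      (inl (emb x) * inr (expHalf P) + inr (emb x)) := by
  rw [hComul_emb]
  refine SemiconjBy.add_right ?_ (commute_jordanianFactor_inr hP)
  rw [jordanianFactor_eq, expHalf, inr_hExp]
  refine semiconjBy_hExp_of_shift (constantCoeff_inl_mul_inr_sigma _ P)
    (constantCoeff_inr (constantCoeff_half_sigma P)) ?_ ?_
  · change inl (emb Hp) * inr (sigma P) * inl (emb x) = _ * (_ * inr (sigma P) + _)
    rw [mul_assoc, ← (commute_inl_inr _ _).eq, ← mul_assoc, ← map_mul, emb_mul_emb, hx, emb_smul,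
      map_add, map_mul, inl_smul, inr_smul, add_mul, mul_add, mul_assoc, smul_mul_assoc,
      mul_smul_comm]
  · exact Commute.mul_left (commute_inl_inr _ _)
      (((Commute.refl (sigma P)).smul_right _).map inr)

end Jordanian

section Extension

variable {a b x : g}

theorem extensionFactor_eq (a b x : g) : extensionFactor (K := K) a b x =
    hExp K (X * tens (emb a) (emb b * expNegHalf x)) := rfl

theorem commute_extensionFactor {t : (U K g ⊗[K] U K g)⟦X⟧}
    (h : Commute t (inl (emb a) * inr (emb b * expNegHalf x))) :
    Commute (extensionFactor (K := K) a b x) t :=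
  (commute_evalSeries (K := K) ((commute_X t).mul_right h) (constantCoeff_X_mul _) _).symm

theorem commute_extensionFactor_inl {c : (U K g)⟦X⟧} (h : Commute c (emb a)) :
    Commute (extensionFactor (K := K) a b x) (inl c) :=
  commute_extensionFactor ((h.map inl).mul_right (commute_inl_inr _ _))

theorem commute_extensionFactor_inr {c : (U K g)⟦X⟧} (h : Commute c (emb b))
    (hx : Commute c (emb x)) : Commute (extensionFactor (K := K) a b x) (inr c) :=
  commute_extensionFactor ((commute_inl_inr _ _).symm.mul_right
    ((h.mul_right (commute_expNegHalf hx)).map inr))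

/-- The commutator of `a ⊗ b` and `y ⊗ 1` gives the action of the extension factor on `y ⊗ 1`. -/
theorem semiconjBy_extensionFactor_inl {y z : g} (hz : ⁅a, y⁆ = z) (haz : ⁅a, z⁆ = 0) :
    SemiconjBy (extensionFactor (K := K) a b x) (inl (emb y))
      (inl (emb y) + X * (inl (emb z) * inr (emb b * expNegHalf x))) := by
  rw [extensionFactor_eq, tens_eq]
  refine semiconjBy_hExp_of_commutator (constantCoeff_X_mul _) ?_ ?_
  · rw [mul_X_mul, mul_assoc, mul_assoc (inl _), ← (commute_inl_inr _ _).eq, ← mul_assoc (inl _),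
      ← map_mul, emb_mul_emb, hz, map_add, map_mul, add_mul, mul_add, mul_assoc (inl _)]
  · refine commute_X_mul_X_mul (Commute.mul_left ?_ ?_)
    · exact ((commute_emb haz).map inl).mul_right (commute_inl_inr _ _)
    · exact (commute_inl_inr _ _).symm.mul_right (Commute.refl _)

end Extension

end JordanianTwist

/-! ### The extended twist, primitivity of H and E_B, and the full twist. -/

namespace JordanianTwist

open PowerSeries

variable {K g : Type*} [Field K] [CharZero K] [LieRing g] [LieAlgebra K g]

theorem lie_eq_zero_symm {x y : g} (h : ⁅x, y⁆ = 0) : ⁅y, x⁆ = 0 := by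
  rw [← lie_skew, h, neg_zero]

theorem emb_mul_emb_mul_expNegHalf {a x : g} (b : g) (h : ⁅a, x⁆ = 0) :
    (emb a * (emb b * expNegHalf x) : (U K g)⟦X⟧) =
      emb b * expNegHalf x * emb a + emb ⁅a, b⁆ * expNegHalf x := by
  rw [← mul_assoc, emb_mul_emb, add_mul, mul_assoc,
    (commute_expNegHalf (commute_emb (K := K) h)).eq, mul_assoc]

/-- An extension pair with quasi-primitive coproducts, with respect to a twist `F`. -/
structure IsExtensionPair (F : (U K g ⊗[K] U K g)⟦X⟧) (a b x : g) : Prop where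
  lie_eq : ⁅a, b⁆ = x
  lie_left : ⁅a, x⁆ = 0
  lie_right : ⁅b, x⁆ = 0
  comul_left : SemiconjBy F (hComul (emb a)) (inl (emb a) * inr (expHalf x) + inr (emb a))
  comul_right : SemiconjBy F (hComul (emb b * expNegHalf x))
    (inl (emb b * expNegHalf x) + inl (expNegHalf x) * inr (emb b * expNegHalf x))

theorem isExtensionPair_jordanianFactor {Hp P a b : g} (hP : ⁅Hp, P⁆ = P)
    (ha : ⁅Hp, a⁆ = (2 : K)⁻¹ • a) (hb : ⁅Hp, b⁆ = (2 : K)⁻¹ • b) (hab : ⁅a, b⁆ = P)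
    (haP : ⁅a, P⁆ = 0) (hbP : ⁅b, P⁆ = 0) :
    IsExtensionPair (jordanianFactor (K := K) Hp (emb P)) a b P where
  lie_eq := hab
  lie_left := haP
  lie_right := hbP
  comul_left := semiconjBy_jordanianFactor_of_half ha haP
  comul_right := by
    have h := (semiconjBy_jordanianFactor_of_half hb hbP).mul_right
      (semiconjBy_hComul_expNegHalf (semiconjBy_jordanianFactor_sigma (K := K) hP))
    rw [← map_mul] at h
    -- The factor e^{-σ/2} attached to b is group-like; it cancels e^{σ/2} on the right of the first
    -- term and leaves q' = e^{-σ/2} on the left of the second.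
    have e : (inl (emb b) * inr (expHalf P) + inr (emb b)) *
        (inl (expNegHalf P) * inr (expNegHalf P)) =
        (inl (emb b * expNegHalf P) + inl (expNegHalf P) * inr (emb b * expNegHalf P) :
          (U K g ⊗[K] U K g)⟦X⟧) := by
      rw [add_mul, map_mul, map_mul, mul_assoc (inl (emb b)), ← mul_assoc (inr (expHalf P)),
        ← (commute_inl_inr (expNegHalf P) (expHalf P)).eq, mul_assoc (inl (expNegHalf P)),
        ← map_mul inr, expHalf_mul_expNegHalf, map_one, mul_one, ← mul_assoc (inr (emb b)),
        ← (commute_inl_inr (expNegHalf P) (emb b)).eq, mul_assoc (inl (expNegHalf P))]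
    rwa [e] at h

theorem IsExtensionPair.isTwist {F : (U K g ⊗[K] U K g)⟦X⟧} {a b x : g}
    (h : IsExtensionPair F a b x) (hF : IsTwist F) : IsTwist (extensionFactor a b x * F) := by
  have ha := commute_emb (K := K) h.lie_left
  have hb := commute_emb (K := K) h.lie_right
  refine hF.extension (q := expHalf x) (R := emb x * expNegHalf x) h.comul_left h.comul_right ?_
    (ha.mul_right (commute_expNegHalf ha)) (X_mul_emb_mul_expNegHalf_add x) (commute_expHalf ha)
    (commute_expNegHalf ha) ?_ (hCounit_emb _) ?_
  · exact (emb_mul_emb_mul_expNegHalf b h.lie_left).trans (by rw [h.lie_eq]; rfl)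
  · exact (commute_expHalf hb).mul_left (commute_expHalf (commute_expNegHalf (Commute.refl _)).symm)
  · rw [map_mul, hCounit_emb, zero_mul]

theorem IsExtensionPair.semiconjBy {F : (U K g ⊗[K] U K g)⟦X⟧} {a b x : g}
    (h : IsExtensionPair F a b x) :
    SemiconjBy (extensionFactor a b x * F) (hComul (emb b * expNegHalf x))
      (inl (emb b * expNegHalf x) + inl (expHalf x) * inr (emb b * expNegHalf x)) := by
  have ha := commute_emb (K := K) h.lie_left
  refine semiconjBy_extension (R := emb x * expNegHalf x) h.comul_right ?_
    (ha.mul_right (commute_expNegHalf ha)) (X_mul_emb_mul_expNegHalf_add x)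
    (commute_expNegHalf ha)
  exact (emb_mul_emb_mul_expNegHalf b h.lie_left).trans (by rw [h.lie_eq]; rfl)

/-- An extension by a commuting pair keeps the quasi-primitive coproducts. -/
theorem IsExtensionPair.extension {F : (U K g ⊗[K] U K g)⟦X⟧} {a b x a' b' : g}
    (h : IsExtensionPair F a b x) (ha'x : ⁅a', x⁆ = 0) (hb'x : ⁅b', x⁆ = 0) (haa : ⁅a, a'⁆ = 0)
    (hab : ⁅a, b'⁆ = 0) (hba : ⁅b, a'⁆ = 0) (hbb : ⁅b, b'⁆ = 0) :
    IsExtensionPair (extensionFactor a' b' x * F) a b x where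
  lie_eq := h.lie_eq
  lie_left := h.lie_left
  lie_right := h.lie_right
  comul_left := by
    refine SemiconjBy.mul_left (SemiconjBy.add_right (SemiconjBy.mul_right ?_ ?_) ?_) h.comul_left
    · exact commute_extensionFactor_inl (commute_emb haa)
    · exact commute_extensionFactor_inr (commute_expHalf (commute_emb hb'x)).symm
        (commute_expHalf (Commute.refl _)).symm
    · exact commute_extensionFactor_inr (commute_emb hab) (commute_emb h.lie_left)
  comul_right := by
    have h1 := (commute_expNegHalf (commute_emb (K := K) ha'x)).symm
    have h2 := (commute_expNegHalf (commute_emb (K := K) hb'x)).symm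
    have h3 : Commute (expNegHalf x) (emb x : (U K g)⟦X⟧) :=
      (commute_expNegHalf (Commute.refl _)).symm
    refine SemiconjBy.mul_left (SemiconjBy.add_right ?_ (SemiconjBy.mul_right ?_ ?_)) h.comul_right
    · exact commute_extensionFactor_inl ((commute_emb hba).mul_left h1)
    · exact commute_extensionFactor_inl h1
    · exact commute_extensionFactor_inr ((commute_emb hbb).mul_left h2)
        ((commute_emb h.lie_right).mul_left h3)

/-- The weights -c and c cancel, so a ⊗ b e^{-σ/2} has total H-weight zero. -/
theorem commute_extensionFactor_of_weights {H a b x : g} {c : K} (ha : ⁅H, a⁆ = -(c • a))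
    (hb : ⁅H, b⁆ = c • b) (hx : ⁅H, x⁆ = 0) :
    Commute (extensionFactor (K := K) a b x) (inl (emb H) + inr (emb H)) := by
  refine commute_extensionFactor ?_
  have e1 : (emb H * emb a : (U K g)⟦X⟧) = emb a * emb H - c • emb a := by
    rw [emb_mul_emb, ha, emb_neg, emb_smul, sub_eq_add_neg]
  have e2 : (emb H * (emb b * expNegHalf x) : (U K g)⟦X⟧) =
      emb b * expNegHalf x * emb H + c • (emb b * expNegHalf x) := by
    rw [emb_mul_emb_mul_expNegHalf b hx, hb, emb_smul, smul_mul_assoc]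
  generalize (emb b * expNegHalf x : (U K g)⟦X⟧) = b' at e2
  have e3 : inl (emb H) * (inl (emb a) * inr b') =
      inl (emb a) * inr b' * inl (emb H) - c • (inl (emb a) * inr b') := by
    rw [← mul_assoc, ← map_mul, e1, map_sub, map_mul, inl_smul, sub_mul, mul_assoc, mul_assoc,
      (commute_inl_inr (emb H) b').eq, smul_mul_assoc]
  have e4 : inr (emb H) * (inl (emb a) * inr b') =
      inl (emb a) * inr b' * inr (emb H) + c • (inl (emb a) * inr b') := by
    rw [← mul_assoc, ← (commute_inl_inr (emb a) (emb H)).eq, mul_assoc, ← map_mul, e2, map_add,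
      map_mul, inr_smul, mul_add, mul_assoc, mul_smul_comm]
  rw [Commute, SemiconjBy, add_mul, e3, e4, mul_add]
  abel

namespace CarrierRelations

variable {H Hp E P A₁ B₁ A₂ B₂ : g}

theorem isExtensionPair_second (D : CarrierRelations K H Hp E P A₁ B₁ A₂ B₂) :
    IsExtensionPair (jordanianFactor (K := K) Hp (emb P)) A₂ B₂ P :=
  isExtensionPair_jordanianFactor D.Hp_P D.Hp_A₂ D.Hp_B₂ D.A₂_B₂ (lie_eq_zero_symm D.P_A₂)
    (lie_eq_zero_symm D.P_B₂)

theorem isExtensionPair_first (D : CarrierRelations K H Hp E P A₁ B₁ A₂ B₂) :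
    IsExtensionPair (extensionFactor A₂ B₂ P * jordanianFactor (K := K) Hp (emb P)) A₁ B₁ P :=
  (isExtensionPair_jordanianFactor D.Hp_P D.Hp_A₁ D.Hp_B₁ D.A₁_B₁ (lie_eq_zero_symm D.P_A₁)
    (lie_eq_zero_symm D.P_B₁)).extension (lie_eq_zero_symm D.P_A₂) (lie_eq_zero_symm D.P_B₂)
    D.A₁_A₂ D.A₁_B₂ (lie_eq_zero_symm D.A₂_B₁) D.B₁_B₂

theorem isTwist_extended (D : CarrierRelations K H Hp E P A₁ B₁ A₂ B₂) :
    IsTwist (extensionFactor (K := K) A₁ B₁ P *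
    (extensionFactor A₂ B₂ P * jordanianFactor Hp (emb P))) :=
  D.isExtensionPair_first.isTwist
    (D.isExtensionPair_second.isTwist (isTwist_jordanianFactor D.Hp_P))

theorem semiconjBy_H (D : CarrierRelations K H Hp E P A₁ B₁ A₂ B₂) :
    SemiconjBy (extensionFactor (K := K) A₁ B₁ P *
    (extensionFactor A₂ B₂ P * jordanianFactor Hp (emb P))) (hComul (emb H))
    (inl (emb H) + inr (emb H)) := by
  exact SemiconjBy.mul_left (commute_extensionFactor_of_weights D.H_A₁ D.H_B₁ D.H_P)
    (SemiconjBy.mul_left (commute_extensionFactor_of_weights D.H_A₂ D.H_B₂ D.H_P)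
      (semiconjBy_jordanianFactor_of_commute D.H_Hp D.H_P))

/-- The Jordanian factor leaves the coproduct of E alone, and each extension factor moves only E⊗1,
by [A₁,E] = -B₂ and [A₂,E] = -B₁. The ħ² term appears because the outer factor also acts on the B₁
produced by the inner one, through [A₁,B₁] = P. -/
theorem semiconjBy_E (D : CarrierRelations K H Hp E P A₁ B₁ A₂ B₂) :
    SemiconjBy (extensionFactor (K := K) A₁ B₁ P *
    (extensionFactor A₂ B₂ P * jordanianFactor Hp (emb P))) (hComul (emb E))
    (inl (emb E) - X * (inl (emb B₂) * inr (emb B₁ * expNegHalf P)) -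
      X * (inl (emb B₁) * inr (emb B₂ * expNegHalf P)) -
      X * (X * (inl (emb P) * inr (emb B₁ * expNegHalf P * (emb B₂ * expNegHalf P)))) +
      inr (emb E)) := by
  have hE1 : Commute (extensionFactor (K := K) A₁ B₁ P) (inr (emb E)) :=
    commute_extensionFactor_inr (commute_emb D.E_B₁) (commute_emb D.E_P)
  have hE2 : Commute (extensionFactor (K := K) A₂ B₂ P) (inr (emb E)) :=
    commute_extensionFactor_inr (commute_emb D.E_B₂) (commute_emb D.E_P)
  have h2 := semiconjBy_extensionFactor_inl (K := K) (b := B₂) (x := P) D.A₂_E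
    (by rw [lie_neg, D.A₂_B₁, neg_zero])
  have h1 := semiconjBy_extensionFactor_inl (K := K) (b := B₁) (x := P) D.A₁_E
    (by rw [lie_neg, D.A₁_B₂, neg_zero])
  have h1B := semiconjBy_extensionFactor_inl (K := K) (b := B₁) (x := P) (y := -B₁) (z := -P)
    (by rw [lie_neg, D.A₁_B₁]) (by rw [lie_neg, lie_eq_zero_symm D.P_A₁, neg_zero])
  have hP : Commute (emb P : (U K g)⟦X⟧) (expNegHalf P) := commute_expNegHalf (Commute.refl _)
  have h1B2 : Commute (extensionFactor (K := K) A₁ B₁ P) (inr (emb B₂ * expNegHalf P)) :=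
    commute_extensionFactor_inr
      ((commute_emb (lie_eq_zero_symm D.B₁_B₂)).mul_left
        (commute_expNegHalf (commute_emb (lie_eq_zero_symm D.P_B₁))).symm)
      ((commute_emb (lie_eq_zero_symm D.P_B₂)).mul_left hP.symm)
  have hJ := semiconjBy_jordanianFactor_of_commute (K := K) (lie_eq_zero_symm D.Hp_E) D.E_P
  have h := SemiconjBy.mul_left ((h1.add_right (SemiconjBy.mul_right (commute_X _)
    (h1B.mul_right h1B2))).add_right hE1) (SemiconjBy.mul_left (h2.add_right hE2) hJ)
  have e : inl (emb E) + X * (inl (emb (-B₂)) * inr (emb B₁ * expNegHalf P)) +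
      X * ((inl (emb (-B₁)) + X * (inl (emb (-P)) * inr (emb B₁ * expNegHalf P))) *
        inr (emb B₂ * expNegHalf P)) + inr (emb E) =
      (inl (emb E) - X * (inl (emb B₂) * inr (emb B₁ * expNegHalf P)) -
      X * (inl (emb B₁) * inr (emb B₂ * expNegHalf P)) -
      X * (X * (inl (emb P) * inr (emb B₁ * expNegHalf P * (emb B₂ * expNegHalf P)))) +
      inr (emb E) : (U K g ⊗[K] U K g)⟦X⟧) := by
    simp only [emb_neg, map_neg, neg_mul, mul_neg, add_mul, mul_add]
    rw [map_mul inr (emb B₁ * expNegHalf P)]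
    simp only [mul_assoc]
    abel
  rw [← e]
  exact h

/-- Sharing e^{-σ} equally between B₂ and B₁ expresses the correction through b₂ and b₁, whose
twisted coproducts are known. -/
theorem deformedE_eq (D : CarrierRelations K H Hp E P A₁ B₁ A₂ B₂) :
    deformedE (K := K) E B₂ B₁ P =
    emb E + X * (emb B₂ * expNegHalf P * (emb B₁ * expNegHalf P)) := by
  have h := commute_expNegHalf (commute_emb (K := K) (lie_eq_zero_symm D.P_B₁))
  rw [deformedE, ← expNegHalf_mul_expNegHalf, mul_assoc (emb B₂) (expNegHalf P),
    ← mul_assoc (expNegHalf P), ← h.eq]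
  simp only [mul_assoc]

theorem semiconjBy_deformedE (D : CarrierRelations K H Hp E P A₁ B₁ A₂ B₂) :
    SemiconjBy (extensionFactor (K := K) A₁ B₁ P *
    (extensionFactor A₂ B₂ P * jordanianFactor Hp (emb P))) (hComul (deformedE E B₂ B₁ P))
    (inl (deformedE E B₂ B₁ P) + inr (deformedE E B₂ B₁ P)) := by
  have hE := D.semiconjBy_E
  have hB₁q := (commute_expHalf (commute_emb (K := K) (lie_eq_zero_symm D.P_B₁)))
  have hB₁ := D.isExtensionPair_first.semiconjBy
  have hq' : Commute (emb P : (U K g)⟦X⟧) (expNegHalf P) := commute_expNegHalf (Commute.refl _)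
  have hB₂A₁ : Commute (emb B₂ * expNegHalf P : (U K g)⟦X⟧) (emb A₁) :=
    (commute_emb (lie_eq_zero_symm D.A₁_B₂)).mul_left
      (commute_expNegHalf (commute_emb (lie_eq_zero_symm D.P_A₁))).symm
  have hB₂B₁ : Commute (emb B₂ * expNegHalf P : (U K g)⟦X⟧) (emb B₁) :=
    (commute_emb (lie_eq_zero_symm D.B₁_B₂)).mul_left
      (commute_expNegHalf (commute_emb (lie_eq_zero_symm D.P_B₁))).symm
  have hB₂P : Commute (emb B₂ * expNegHalf P : (U K g)⟦X⟧) (emb P) :=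
    (commute_emb (lie_eq_zero_symm D.P_B₂)).mul_left hq'.symm
  have hbb : Commute (emb B₂ * expNegHalf P : (U K g)⟦X⟧) (emb B₁ * expNegHalf P) :=
    hB₂B₁.mul_right (commute_expNegHalf hB₂P)
  have hB₂ : SemiconjBy (extensionFactor (K := K) A₁ B₁ P *
      (extensionFactor A₂ B₂ P * jordanianFactor Hp (emb P))) (hComul (emb B₂ * expNegHalf P))
      (inl (emb B₂ * expNegHalf P) + inl (expHalf P) * inr (emb B₂ * expNegHalf P)) := by
    refine SemiconjBy.mul_left (SemiconjBy.add_right ?_ (SemiconjBy.mul_right ?_ ?_))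
      D.isExtensionPair_second.semiconjBy
    · exact commute_extensionFactor_inl hB₂A₁
    · exact commute_extensionFactor_inl
        (commute_expHalf (commute_emb (lie_eq_zero_symm D.P_A₁))).symm
    · exact commute_extensionFactor_inr hB₂B₁ hB₂P
  have h := hE.add_right (SemiconjBy.mul_right (commute_X _) (hB₂.mul_right hB₁))
  rw [D.deformedE_eq, map_add, map_mul, hComul_X, map_mul hComul (emb B₂ * expNegHalf P)]
  have e1 : (emb B₂ * expNegHalf P * expHalf P : (U K g)⟦X⟧) = emb B₂ := by
    rw [mul_assoc, expNegHalf_mul_expHalf, mul_one]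
  have e2 : (expHalf P * (emb B₁ * expNegHalf P) : (U K g)⟦X⟧) = emb B₁ := by
    rw [← mul_assoc, ← hB₁q.eq, mul_assoc, expHalf_mul_expNegHalf, mul_one]
  generalize (emb B₁ * expNegHalf P : (U K g)⟦X⟧) = b₁ at *
  generalize (emb B₂ * expNegHalf P : (U K g)⟦X⟧) = b₂ at *
  -- In the expansion e^{σ/2} absorbs e^{-σ/2} in the mixed terms, and e^σ = 1+ħP in the last. Apart
  -- from the primitive part, these are the negatives of the unwanted terms in the coproduct of E.
  have e3 : (inl b₂ + inl (expHalf P) * inr b₂) * (inl b₁ + inl (expHalf P) * inr b₁) =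
      inl (b₂ * b₁) + inl (emb B₂) * inr b₁ + inl (emb B₁) * inr b₂ +
        inr (b₂ * b₁) + X * (inl (emb P) * inr (b₁ * b₂)) := by
    have e4 : inl (expHalf P) * inr b₂ * inl b₁ = inl (emb B₁) * inr b₂ := by
      rw [mul_assoc, ← (commute_inl_inr b₁ b₂).eq, ← mul_assoc, ← map_mul, e2]
    have e5 : inl b₂ * (inl (expHalf P) * inr b₁) = inl (emb B₂) * inr b₁ := by
      rw [← mul_assoc, ← map_mul, e1]
    have e6 : inl (expHalf P) * inr b₂ * (inl (expHalf P) * inr b₁) =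
        inr (b₂ * b₁) + X * (inl (emb P) * inr (b₁ * b₂)) := by
      rw [mul_assoc, ← mul_assoc (inr b₂), ← (commute_inl_inr (expHalf P) b₂).eq,
        mul_assoc (inl (expHalf P)), ← mul_assoc, ← map_mul, ← map_mul, expHalf_mul_expHalf,
        map_add, map_one, map_mul, inl_X, add_mul, one_mul, hbb.eq, mul_assoc X]
    rw [add_mul, mul_add, mul_add, e4, e5, e6, map_mul inl]
    abel
  rw [e3] at h
  have e7 : inl (emb E + X * (b₂ * b₁)) + inr (emb E + X * (b₂ * b₁)) =
      inl (emb E) - X * (inl (emb B₂) * inr b₁) - X * (inl (emb B₁) * inr b₂) -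
      X * (X * (inl (emb P) * inr (b₁ * b₂))) + inr (emb E) +
      X * (inl (b₂ * b₁) + inl (emb B₂) * inr b₁ + inl (emb B₁) * inr b₂ +
        inr (b₂ * b₁) + X * (inl (emb P) * inr (b₁ * b₂))) := by
    rw [map_add, map_add, map_mul inl X, map_mul inr X, inl_X, inr_X]
    simp only [mul_add]
    abel
  rw [e7]
  exact h

/-- The correction has H-weight 1/2 + 1/2 = 1, the weight of E, since e^{-σ} commutes with H. -/
theorem emb_mul_deformedE (D : CarrierRelations K H Hp E P A₁ B₁ A₂ B₂) :
    (emb H * deformedE E B₂ B₁ P : (U K g)⟦X⟧) =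
    deformedE E B₂ B₁ P * emb H + deformedE E B₂ B₁ P := by
  have hb : ∀ {B : g}, ⁅H, B⁆ = (2 : K)⁻¹ • B → (emb H * (emb B * expNegHalf P) : (U K g)⟦X⟧) =
      emb B * expNegHalf P * emb H + (2 : K)⁻¹ • (emb B * expNegHalf P) := by
    intro B hB
    rw [emb_mul_emb_mul_expNegHalf B D.H_P, hB, emb_smul, smul_mul_assoc]
  have h1 := hb D.H_B₁
  have h2 := hb D.H_B₂
  rw [D.deformedE_eq]
  generalize (emb B₁ * expNegHalf P : (U K g)⟦X⟧) = b₁ at h1 ⊢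
  generalize (emb B₂ * expNegHalf P : (U K g)⟦X⟧) = b₂ at h2 ⊢
  have e : emb H * (b₂ * b₁) = b₂ * b₁ * emb H + b₂ * b₁ := by
    rw [← mul_assoc, h2, add_mul, mul_assoc, h1, mul_add, add_assoc, smul_mul_assoc,
      mul_smul_comm, half_add_half, mul_assoc]
  rw [mul_add, emb_mul_emb, D.H_E, mul_X_mul, e, mul_add, add_mul, mul_assoc X]
  abel

theorem hCounit_deformedE (D : CarrierRelations K H Hp E P A₁ B₁ A₂ B₂) :
    hCounit (deformedE (K := K) E B₂ B₁ P) = 0 := by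
  simp [D.deformedE_eq, hCounit_emb]

theorem isTwist_full (D : CarrierRelations K H Hp E P A₁ B₁ A₂ B₂) :
    IsTwist (jordanianFactor H (deformedE (K := K) E B₂ B₁ P) *
    (extensionFactor (K := K) A₁ B₁ P * (extensionFactor A₂ B₂ P * jordanianFactor Hp (emb P)))) :=
  D.isTwist_extended.jordanian D.semiconjBy_H D.semiconjBy_deformedE D.emb_mul_deformedE
    (hCounit_emb _) D.hCounit_deformedE

end CarrierRelations

end JordanianTwist

/-! ### Recovering a Lie subalgebra d from the image of U(d), without a basis of U(g). -/

namespace JordanianTwist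

open PowerSeries

attribute [local instance 100] LieRing.ofAssociativeRing

section Primitive

variable {K g : Type*} [Field K] [LieRing g] [LieAlgebra K g]

local notation "ι" => UniversalEnvelopingAlgebra.ι

/-- The adjoint representation factors through U(g), and it is faithful because the centre is
trivial. -/
theorem ι_injective [FiniteDimensional K g] [LieAlgebra.IsKilling K g] :
    Function.Injective (ι K : g →ₗ⁅K⁆ U K g) := by
  have h : Function.Injective (LieAlgebra.ad K g) := by
    rw [← LieHom.ker_eq_bot, LieAlgebra.ad_ker_eq_self_module_ker,
      LieAlgebra.self_module_ker_eq_center, LieAlgebra.center_eq_bot]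
  intro x y hxy
  apply h
  rw [← UniversalEnvelopingAlgebra.lift_ι_apply K (LieAlgebra.ad K g) x, hxy,
    UniversalEnvelopingAlgebra.lift_ι_apply]

theorem ι_mul_ι (x y : g) : (ι K x * ι K y : U K g) = ι K y * ι K x + ι K ⁅x, y⁆ := by
  rw [LieHom.map_lie, LieRing.of_associative_ring_bracket, add_sub_cancel]

theorem comul_ι (x : g) : comul K g (ι K x) = ι K x ⊗ₜ 1 + 1 ⊗ₜ ι K x := by
  simp [comul, UniversalEnvelopingAlgebra.lift_ι_apply']

theorem counit_ι (x : g) : counit K g (ι K x) = 0 := by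
  simp [counit, UniversalEnvelopingAlgebra.lift_ι_apply']

/-- The homomorphism `U(d) → U(g)` induced by the inclusion of a Lie subalgebra `d`. -/
noncomputable abbrev inclU (d : LieSubalgebra K g) : U K d →ₐ[K] U K g :=
  UniversalEnvelopingAlgebra.lift K ((ι K).comp d.incl)

theorem ι_mem_range_inclU {d : LieSubalgebra K g} {x : g} (hx : x ∈ d) :
    (ι K x : U K g) ∈ (inclU d).range :=
  ⟨ι K (⟨x, hx⟩ : d), UniversalEnvelopingAlgebra.lift_ι_apply K ((ι K).comp d.incl) _⟩

theorem range_inclU_le {d : LieSubalgebra K g} {S : Subalgebra K (U K g)}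
    (h : ∀ x ∈ d, ι K x ∈ S) : (inclU d).range ≤ S := by
  let f : d →ₗ⁅K⁆ S :=
    { toFun := fun x => ⟨ι K (x : g), h x x.2⟩
      map_add' := fun x y => Subtype.ext (map_add (ι K) (x : g) y)
      map_smul' := fun c x => Subtype.ext (map_smul (ι K) c (x : g))
      map_lie' := fun {x y} => Subtype.ext (LieHom.map_lie (ι K) (x : g) y) }
  have hf : S.val.comp (UniversalEnvelopingAlgebra.lift K f) = inclU d := by
    apply UniversalEnvelopingAlgebra.hom_ext
    ext x
    simp only [LieHom.comp_apply, AlgHom.coe_toLieHom, AlgHom.comp_apply, inclU,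
      UniversalEnvelopingAlgebra.lift_ι_apply]
    rfl
  rw [← hf]
  rintro _ ⟨u, rfl⟩
  exact (UniversalEnvelopingAlgebra.lift K f u).2

variable (K) in
/-- The span of `1` and `d` in `U(g)`, whose powers form the canonical filtration. -/
noncomputable def filtrationOne (d : LieSubalgebra K g) : Submodule K (U K g) :=
  1 ⊔ d.toSubmodule.map (ι K : g →ₗ⁅K⁆ U K g).toLinearMap

variable (K) in
/-- The elements of `U(d)` of degree `< n`. -/
noncomputable def filtrationLT (d : LieSubalgebra K g) : ℕ → Submodule K (U K g)
  | 0 => ⊥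
  | n + 1 => filtrationOne K d ^ n

variable {d : LieSubalgebra K g}

theorem mem_filtrationOne {u : U K g} :
    u ∈ filtrationOne K d ↔ ∃ c : K, ∃ x ∈ d, u = algebraMap K _ c + ι K x := by
  rw [filtrationOne, Submodule.mem_sup]
  constructor
  · rintro ⟨_, h, _, ⟨x, hx, rfl⟩, rfl⟩
    obtain ⟨c, rfl⟩ := Submodule.mem_one.mp h
    exact ⟨c, x, hx, rfl⟩
  · rintro ⟨c, x, hx, rfl⟩
    exact ⟨_, Submodule.mem_one.mpr ⟨c, rfl⟩, _, ⟨x, hx, rfl⟩, rfl⟩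

theorem one_mem_filtrationOne : (1 : U K g) ∈ filtrationOne K d :=
  mem_filtrationOne.mpr ⟨1, 0, d.zero_mem, by simp⟩

theorem ι_mem_filtrationOne {x : g} (hx : x ∈ d) : ι K x ∈ filtrationOne K d :=
  mem_filtrationOne.mpr ⟨0, x, hx, by simp⟩

theorem filtrationOne_pow_mono {m n : ℕ} (h : m ≤ n) :
    filtrationOne K d ^ m ≤ filtrationOne K d ^ n := by
  obtain ⟨k, rfl⟩ := Nat.exists_eq_add_of_le h
  rw [pow_add]
  intro u hu
  have h1 : (1 : U K g) ∈ filtrationOne K d ^ k := by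
    have := Submodule.pow_mem_pow (filtrationOne K d) one_mem_filtrationOne k
    rwa [one_pow] at this
  simpa using Submodule.mul_mem_mul hu h1

theorem filtrationLT_le {n : ℕ} : filtrationLT K d n ≤ filtrationOne K d ^ n := by
  cases n with
  | zero => exact bot_le
  | succ n => exact filtrationOne_pow_mono n.le_succ

theorem mul_mem_filtrationLT {m u : U K g} {n : ℕ} (hm : m ∈ filtrationOne K d)
    (hu : u ∈ filtrationLT K d n) : m * u ∈ filtrationLT K d (n + 1) := by
  cases n with
  | zero =>
    rw [filtrationLT, Submodule.mem_bot] at hu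
    rw [hu, mul_zero]
    exact Submodule.zero_mem _
  | succ n =>
    change m * u ∈ filtrationOne K d ^ (n + 1)
    rw [pow_succ']
    exact Submodule.mul_mem_mul hm hu

/-- The map [y,·] is a derivation sending d to d and killing scalars, so it does not raise degree.
Exchanging y with w thus costs only terms of lower degree than yw. -/
theorem lie_mem_filtrationOne_pow {y : g} (hy : y ∈ d) {n : ℕ} {w : U K g}
    (hw : w ∈ filtrationOne K d ^ n) : ι K y * w - w * ι K y ∈ filtrationOne K d ^ n := by
  induction n generalizing w with
  | zero =>
    rw [pow_zero] at hw ⊢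
    obtain ⟨c, rfl⟩ := Submodule.mem_one.mp hw
    rw [(Algebra.commutes c (ι K y : U K g)), sub_self]
    exact Submodule.zero_mem _
  | succ n ih =>
    rw [pow_succ'] at hw ⊢
    refine Submodule.mul_induction_on hw (fun m hm v hv => ?_) fun a b ha hb => ?_
    · obtain ⟨c, x, hx, rfl⟩ := mem_filtrationOne.mp hm
      have h : ι K y * ((algebraMap K _ c + ι K x) * v) - (algebraMap K _ c + ι K x) * v * ι K y =
          ι K ⁅y, x⁆ * v + (algebraMap K _ c + ι K x) * (ι K y * v - v * ι K y) := by
        have h1 := ι_mul_ι (K := K) y x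
        rw [← mul_assoc, mul_add, h1, ← Algebra.commutes c (ι K y : U K g)]
        noncomm_ring
      rw [h]
      exact Submodule.add_mem _
        (Submodule.mul_mem_mul (ι_mem_filtrationOne (d.lie_mem hy hx)) hv)
        (Submodule.mul_mem_mul hm (ih hv))
    · have h : ι K y * (a + b) - (a + b) * ι K y =
          (ι K y * a - a * ι K y) + (ι K y * b - b * ι K y) := by noncomm_ring
      rw [h]
      exact Submodule.add_mem _ ha hb

/-- `a ⊗ b ↦ a w b`. -/
noncomputable def sandwich (w : U K g) : U K g ⊗[K] U K g →ₗ[K] U K g :=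
  LinearMap.mul' K (U K g) ∘ₗ LinearMap.mulLeft K ((1 : U K g) ⊗ₜ[K] w)

theorem sandwich_tmul (w a b : U K g) : sandwich w (a ⊗ₜ b) = a * (w * b) := by
  simp [sandwich]

theorem sandwich_left_mul (w y : U K g) (t : U K g ⊗[K] U K g) :
    sandwich w (y ⊗ₜ 1 * t) = y * sandwich w t := by
  induction t with
  | zero => simp
  | add a b ha hb => rw [mul_add, map_add, ha, hb, map_add, mul_add]
  | tmul a b => simp only [Algebra.TensorProduct.tmul_mul_tmul, sandwich_tmul, one_mul, mul_assoc]

theorem sandwich_right_mul (w y : U K g) (t : U K g ⊗[K] U K g) :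
    sandwich w (1 ⊗ₜ y * t) = sandwich (w * y) t := by
  induction t with
  | zero => simp
  | add a b ha hb => rw [mul_add, map_add, ha, hb, map_add]
  | tmul a b => simp only [Algebra.TensorProduct.tmul_mul_tmul, sandwich_tmul, one_mul, mul_assoc]

/-- On elements of degree `n`, the map `u ↦ ∑ u' w u''` is multiplication by `2ⁿ w`, up to terms
of lower degree. -/
theorem sandwich_comul_sub_mem {n k : ℕ} {w u : U K g} (hw : w ∈ filtrationOne K d ^ k)
    (hu : u ∈ filtrationOne K d ^ n) :
    sandwich w (comul K g u) - (2 : K) ^ n • (w * u) ∈ filtrationLT K d (n + k) := by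
  induction n generalizing k w u with
  | zero =>
    rw [pow_zero] at hu
    obtain ⟨c, rfl⟩ := Submodule.mem_one.mp hu
    rw [AlgHom.commutes, Algebra.TensorProduct.algebraMap_apply, sandwich_tmul, pow_zero, one_smul,
      mul_one, Algebra.commutes, sub_self]
    exact Submodule.zero_mem _
  | succ n ih =>
    rw [pow_succ'] at hu
    refine Submodule.mul_induction_on hu (fun m hm v hv => ?_) fun a b ha hb => ?_
    · obtain ⟨c, y, hy, rfl⟩ := mem_filtrationOne.mp hm
      have hι := ι_mem_filtrationOne (K := K) hy
      have h1 := ih hw hv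
      have hwy : w * ι K y ∈ filtrationOne K d ^ (k + 1) := by
        rw [pow_succ]
        exact Submodule.mul_mem_mul hw hι
      have h2 := ih hwy hv
      have h3 := mul_mem_filtrationLT hι h1
      have h4 := Submodule.mul_mem_mul (lie_mem_filtrationOne_pow hy hw) hv
      have h5 := Submodule.mul_mem_mul hw hv
      rw [← pow_add, add_comm k n] at h4 h5
      have e : n + 1 + k = n + k + 1 := by omega
      -- A left factor y of the argument goes either outside or next to w. The second case is why
      -- the induction must allow arbitrary w and not only w = 1.
      have e1 : sandwich w (comul K g ((algebraMap K _ c + ι K y) * v)) =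
          c • sandwich w (comul K g v) + (ι K y * sandwich w (comul K g v) +
            sandwich (w * ι K y) (comul K g v)) := by
        rw [add_mul, map_add, map_mul, map_mul, AlgHom.commutes, comul_ι, add_mul, map_add,
          map_add, sandwich_left_mul, sandwich_right_mul, ← Algebra.smul_def, map_smul]
      -- Both placements of y contribute 2ⁿ w y v to leading order, which doubles the factor; the
      -- commutator [y,w]v and the scalar terms have lower degree.
      have e2 : sandwich w (comul K g ((algebraMap K _ c + ι K y) * v)) -
          (2 : K) ^ (n + 1) • (w * ((algebraMap K _ c + ι K y) * v)) =
          c • (sandwich w (comul K g v) - (2 : K) ^ n • (w * v)) +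
          ι K y * (sandwich w (comul K g v) - (2 : K) ^ n • (w * v)) +
          (sandwich (w * ι K y) (comul K g v) - (2 : K) ^ n • (w * ι K y * v)) +
          ((2 : K) ^ n • ((ι K y * w - w * ι K y) * v) - (c * (2 : K) ^ n) • (w * v)) := by
        have e3 : w * ((algebraMap K _ c + ι K y) * v) = c • (w * v) + w * ι K y * v := by
          rw [add_mul, mul_add, ← mul_assoc, ← mul_assoc, ← Algebra.commutes, mul_assoc,
            ← Algebra.smul_def]
        rw [e1, e3, sub_mul, mul_sub, mul_smul_comm, mul_assoc (ι K y)]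
        module
      rw [e2, e]
      refine Submodule.add_mem _ (Submodule.add_mem _ (Submodule.add_mem _
        (Submodule.smul_mem _ _ (filtrationLT_le h1)) h3) h2) ?_
      exact Submodule.sub_mem _ (Submodule.smul_mem _ _ h4) (Submodule.smul_mem _ _ h5)
    · have h : sandwich w (comul K g (a + b)) - (2 : K) ^ (n + 1) • (w * (a + b)) =
          (sandwich w (comul K g a) - (2 : K) ^ (n + 1) • (w * a)) +
          (sandwich w (comul K g b) - (2 : K) ^ (n + 1) • (w * b)) := by
        rw [map_add, map_add, mul_add, smul_add]
        abel
      rw [h]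
      exact Submodule.add_mem _ ha hb

theorem exists_mem_filtrationOne_pow {u : U K g} (hu : u ∈ (inclU d).range) :
    ∃ n, u ∈ filtrationOne K d ^ n := by
  let S : Subalgebra K (U K g) :=
    { carrier := {u | ∃ n, u ∈ filtrationOne K d ^ n}
      mul_mem' := by
        rintro a b ⟨m, hm⟩ ⟨n, hn⟩
        exact ⟨m + n, by rw [pow_add]; exact Submodule.mul_mem_mul hm hn⟩
      add_mem' := by
        rintro a b ⟨m, hm⟩ ⟨n, hn⟩
        exact ⟨max m n, Submodule.add_mem _ (filtrationOne_pow_mono (le_max_left _ _) hm)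
          (filtrationOne_pow_mono (le_max_right _ _) hn)⟩
      algebraMap_mem' := fun c => ⟨0, by rw [pow_zero]; exact Submodule.mem_one.mpr ⟨c, rfl⟩⟩ }
  refine range_inclU_le (S := S) (fun x hx => ⟨1, ?_⟩) hu
  rw [pow_one]
  exact ι_mem_filtrationOne hx

/-- Multiplication after Δ doubles x, but acts by 2^{n+1} modulo lower degree when x has degree at
most n+1. Hence (2 - 2^{n+1})x has degree at most n, and the scalar is nonzero for n > 0, so the
degree descends to 1. -/
theorem mem_filtrationOne_of_primitive [CharZero K] {x : g} {n : ℕ}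
    (hx : (ι K x : U K g) ∈ filtrationOne K d ^ n) : ι K x ∈ filtrationOne K d := by
  induction n with
  | zero => exact (pow_one (filtrationOne K d)).le (filtrationOne_pow_mono zero_le_one hx)
  | succ n ih =>
    rcases Nat.eq_zero_or_pos n with rfl | hn
    · rwa [zero_add, pow_one] at hx
    · refine ih ?_
      have h := sandwich_comul_sub_mem (w := 1) (k := 0)
        (by rw [pow_zero]; exact Submodule.one_le.mp le_rfl) hx
      have e : sandwich 1 (comul K g (ι K x)) - (2 : K) ^ (n + 1) • (1 * ι K x) =
          ((2 : K) - 2 ^ (n + 1)) • ι K x := by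
        rw [comul_ι, map_add, sandwich_tmul, sandwich_tmul]
        simp only [one_mul, mul_one]
        module
      rw [e] at h
      refine (Submodule.smul_mem_iff _ ?_).mp h
      rw [sub_ne_zero]
      norm_cast
      have := Nat.one_lt_two_pow hn.ne'
      rw [pow_succ]
      omega

/-- A Lie subalgebra `d` of `g` is recovered from the image of `U(d)` in `U(g)`. -/
theorem mem_of_ι_mem_range [CharZero K] [FiniteDimensional K g] [LieAlgebra.IsKilling K g] {x : g}
    (hx : (ι K x : U K g) ∈ (inclU d).range) : x ∈ d := by
  obtain ⟨n, hn⟩ := exists_mem_filtrationOne_pow hx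
  obtain ⟨c, y, hy, h⟩ := mem_filtrationOne.mp (mem_filtrationOne_of_primitive hn)
  have hc := congrArg (counit K g) h
  rw [map_add, counit_ι, counit_ι, AlgHom.commutes, add_zero, Algebra.algebraMap_self,
    RingHom.id_apply] at hc
  rw [← hc, map_zero, zero_add] at h
  rwa [ι_injective h]

end Primitive

end JordanianTwist

/-! ### Supports, the carrier algebra, and the deformed Borel subalgebra. -/

namespace JordanianTwist

open PowerSeries

section Coefficients

variable {K A : Type*} [Field K] [Ring A] [Algebra K A]

/-- The power series all of whose coefficients lie in a subalgebra. -/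
def seriesOver (S : Subalgebra K A) : Subring A⟦X⟧ where
  carrier := {a | ∀ n, coeff n a ∈ S}
  mul_mem' := fun {a b} ha hb n => by
    rw [coeff_mul]
    exact Subalgebra.sum_mem _ fun p _ => S.mul_mem (ha _) (hb _)
  one_mem' := fun n => by
    rw [coeff_one]
    split_ifs
    exacts [S.one_mem, S.zero_mem]
  add_mem' := fun {a b} ha hb n => by
    rw [map_add]
    exact S.add_mem (ha n) (hb n)
  zero_mem' := fun n => by
    rw [map_zero]
    exact S.zero_mem
  neg_mem' := fun {a} ha n => by
    rw [map_neg]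
    exact S.neg_mem (ha n)

theorem X_mem_seriesOver (S : Subalgebra K A) : X ∈ seriesOver S := fun n => by
  rw [coeff_X]
  split_ifs
  exacts [S.one_mem, S.zero_mem]

theorem smul_mem_seriesOver {S : Subalgebra K A} {a : A⟦X⟧} (ha : a ∈ seriesOver S) (c : K) :
    c • a ∈ seriesOver S :=
  fun n => S.smul_mem (ha n) c

theorem evalSeries_mem_seriesOver {S : Subalgebra K A} {a : A⟦X⟧} (ha : a ∈ seriesOver S)
    (f : K⟦X⟧) : evalSeries f a ∈ seriesOver S := fun n => by
  rw [evalSeries, coeff_mk]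
  exact Subalgebra.sum_mem _ fun k _ => S.smul_mem (pow_mem ha k n) _

end Coefficients

section Support

variable {K g : Type*} [Field K] [LieRing g] [LieAlgebra K g] {d : LieSubalgebra K g}

theorem isSupportedOn_iff {F : (U K g ⊗[K] U K g)⟦X⟧} :
    IsSupportedOn F d ↔ F ∈ seriesOver (Algebra.TensorProduct.map (inclU d) (inclU d)).range :=
  Iff.rfl

theorem emb_mem_seriesOver {x : g} (hx : x ∈ d) :
    (emb x : (U K g)⟦X⟧) ∈ seriesOver (inclU d).range := fun n => by
  rw [emb, coeff_C]
  split_ifs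
  exacts [ι_mem_range_inclU hx, Subalgebra.zero_mem _]

theorem tens_mem_seriesOver {a b : (U K g)⟦X⟧} (ha : a ∈ seriesOver (inclU d).range)
    (hb : b ∈ seriesOver (inclU d).range) :
    tens a b ∈ seriesOver (Algebra.TensorProduct.map (inclU d) (inclU d)).range := by
  refine Subring.mul_mem _ (fun n => ?_) fun n => ?_
  · obtain ⟨v, hv⟩ := ha n
    exact ⟨v ⊗ₜ 1, by simp [← hv]⟩
  · obtain ⟨v, hv⟩ := hb n
    exact ⟨1 ⊗ₜ v, by simp [← hv]⟩

/-- The functional is defined on all of U(g), so no compatibility with d is required: the surviving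
leg stays in the image of U(d). -/
theorem lid_rTensor_mem_range (φ : U K g →ₗ[K] K) {t : U K g ⊗[K] U K g}
    (ht : t ∈ (Algebra.TensorProduct.map (inclU d) (inclU d)).range) :
    TensorProduct.lid K (U K g) (φ.rTensor (U K g) t) ∈ (inclU d).range := by
  obtain ⟨s, rfl⟩ := ht
  induction s with
  | zero => simp
  | add a b ha hb =>
    have := Subalgebra.add_mem _ ha hb
    simpa only [map_add] using this
  | tmul a b =>
    have h : inclU d b ∈ (inclU d).range := ⟨b, rfl⟩
    exact Subalgebra.smul_mem _ h _

theorem rid_lTensor_mem_range (φ : U K g →ₗ[K] K) {t : U K g ⊗[K] U K g}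
    (ht : t ∈ (Algebra.TensorProduct.map (inclU d) (inclU d)).range) :
    TensorProduct.rid K (U K g) (φ.lTensor (U K g) t) ∈ (inclU d).range := by
  obtain ⟨s, rfl⟩ := ht
  induction s with
  | zero => simp
  | add a b ha hb =>
    have := Subalgebra.add_mem _ ha hb
    simpa only [map_add] using this
  | tmul a b =>
    have h : inclU d a ∈ (inclU d).range := ⟨a, rfl⟩
    exact Subalgebra.smul_mem _ h _

theorem coeff_one_tens {x : g} {b : (U K g)⟦X⟧} :
    coeff 1 (tens (emb x) b) = UniversalEnvelopingAlgebra.ι K x ⊗ₜ coeff 1 b := by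
  rw [tens, emb, PowerSeries.map_C, coeff_C_mul, coeff_map]
  simp

theorem constantCoeff_emb (x : g) :
    constantCoeff (emb x : (U K g)⟦X⟧) = UniversalEnvelopingAlgebra.ι K x :=
  constantCoeff_C _

theorem coeff_one_mul_of_constantCoeff {A : Type*} [Ring A] {a b : A⟦X⟧}
    (ha : constantCoeff a = 1) (hb : constantCoeff b = 1) :
    coeff 1 (a * b) = coeff 1 a + coeff 1 b := by
  rw [coeff_mul, Finset.Nat.antidiagonal_succ]
  simp [ha, hb, add_comm]

end Support

section Factors

variable {K g : Type*} [Field K] [CharZero K] [LieRing g] [LieAlgebra K g]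
  {d : LieSubalgebra K g}

theorem sigma_mem_seriesOver {x : g} (hx : x ∈ d) :
    (sigma x : (U K g)⟦X⟧) ∈ seriesOver (inclU d).range :=
  evalSeries_mem_seriesOver (Subring.mul_mem _ (X_mem_seriesOver _) (emb_mem_seriesOver hx)) _

theorem jordanianFactor_mem_seriesOver {H : g} {y : (U K g)⟦X⟧} (hH : H ∈ d)
    (hy : y ∈ seriesOver (inclU d).range) : jordanianFactor H y ∈
      seriesOver (Algebra.TensorProduct.map (inclU d) (inclU d)).range :=
  evalSeries_mem_seriesOver (tens_mem_seriesOver (emb_mem_seriesOver hH)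
    (evalSeries_mem_seriesOver (Subring.mul_mem _ (X_mem_seriesOver _) hy) _)) _

theorem extensionFactor_mem_seriesOver {a b x : g} (ha : a ∈ d) (hb : b ∈ d) (hx : x ∈ d) :
    extensionFactor (K := K) a b x ∈
      seriesOver (Algebra.TensorProduct.map (inclU d) (inclU d)).range :=
  evalSeries_mem_seriesOver (Subring.mul_mem _ (X_mem_seriesOver _)
    (tens_mem_seriesOver (emb_mem_seriesOver ha) (Subring.mul_mem _ (emb_mem_seriesOver hb)
      (evalSeries_mem_seriesOver (Subring.neg_mem _
        (smul_mem_seriesOver (sigma_mem_seriesOver hx) _)) _)))) _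

theorem deformedE_mem_seriesOver {E b a x : g} (hE : E ∈ d) (hb : b ∈ d) (ha : a ∈ d)
    (hx : x ∈ d) : deformedE (K := K) E b a x ∈ seriesOver (inclU d).range :=
  Subring.add_mem _ (emb_mem_seriesOver hE) (Subring.mul_mem _ (X_mem_seriesOver _)
    (Subring.mul_mem _ (Subring.mul_mem _ (emb_mem_seriesOver hb) (emb_mem_seriesOver ha))
      (evalSeries_mem_seriesOver (Subring.neg_mem _ (sigma_mem_seriesOver hx)) _)))

theorem coeff_one_jordanianFactor (H : g) (y : (U K g)⟦X⟧) :
    coeff 1 (jordanianFactor H y) = UniversalEnvelopingAlgebra.ι K H ⊗ₜ constantCoeff y := by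
  rw [jordanianFactor, coeff_one_hExp, coeff_one_tens, coeff_one_hLogOneAdd]
  congr 1
  exact (coeff_succ_X_mul 0 y).trans (coeff_zero_eq_constantCoeff_apply y)

theorem coeff_one_extensionFactor (a b x : g) : coeff 1 (extensionFactor (K := K) a b x) =
    UniversalEnvelopingAlgebra.ι K a ⊗ₜ UniversalEnvelopingAlgebra.ι K b := by
  rw [extensionFactor, coeff_one_hExp, coeff_succ_X_mul 0, tens, emb, PowerSeries.map_C,
    coeff_C_mul, coeff_map, coeff_zero_eq_constantCoeff_apply, map_mul, constantCoeff_emb,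
    constantCoeff_hExp]
  simp

theorem constantCoeff_deformedE (E b a x : g) :
    constantCoeff (deformedE (K := K) E b a x) = UniversalEnvelopingAlgebra.ι K E := by
  rw [deformedE, map_add, constantCoeff_X_mul, add_zero, constantCoeff_emb]

end Factors

namespace CarrierRelations

variable {K g : Type*} [Field K] [LieRing g] [LieAlgebra K g]
  {H Hp E P A₁ B₁ A₂ B₂ : g}

theorem lie_mem_span (D : CarrierRelations K H Hp E P A₁ B₁ A₂ B₂) {x y : g}
    (hx : x ∈ Submodule.span K {H, Hp, E, P, A₁, B₁, A₂, B₂})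
    (hy : y ∈ Submodule.span K {H, Hp, E, P, A₁, B₁, A₂, B₂}) :
    ⁅x, y⁆ ∈ Submodule.span K {H, Hp, E, P, A₁, B₁, A₂, B₂} := by
  set S := Submodule.span K {H, Hp, E, P, A₁, B₁, A₂, B₂} with hS
  have hs : ∀ z ∈ ({H, Hp, E, P, A₁, B₁, A₂, B₂} : Set g), z ∈ S :=
    fun z hz => Submodule.subset_span hz
  simp only [Set.mem_insert_iff, Set.mem_singleton_iff, forall_eq_or_imp, forall_eq] at hs
  obtain ⟨hH, hHp, hE, hP, hA₁, hB₁, hA₂, hB₂⟩ := hs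
  have key : ∀ z ∈ ({H, Hp, E, P, A₁, B₁, A₂, B₂} : Set g),
      ∀ w ∈ ({H, Hp, E, P, A₁, B₁, A₂, B₂} : Set g), ⁅z, w⁆ ∈ S := by
    simp only [Set.mem_insert_iff, Set.mem_singleton_iff, forall_eq_or_imp, forall_eq]
    refine ⟨?_, ?_, ?_, ?_, ?_, ?_, ?_, ?_⟩ <;> refine ⟨?_, ?_, ?_, ?_, ?_, ?_, ?_, ?_⟩
    all_goals
      -- The relations record each bracket in one order only; the second alternative covers the
      -- reversed order by antisymmetry.
      first
      | simp only [lie_self, D.H_Hp, D.H_E, D.H_P, D.H_A₁, D.H_B₁, D.H_A₂, D.H_B₂, D.Hp_E, D.Hp_P,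
          D.Hp_A₁, D.Hp_B₁, D.Hp_A₂, D.Hp_B₂, D.E_P, D.A₁_E, D.E_B₁, D.A₂_E, D.E_B₂, D.P_A₁,
          D.P_B₁, D.P_A₂, D.P_B₂, D.A₁_B₁, D.A₁_A₂, D.A₁_B₂, D.A₂_B₁, D.B₁_B₂, D.A₂_B₂,
          Submodule.zero_mem, Submodule.neg_mem_iff, Submodule.smul_mem, hE, hP, hA₁, hB₁, hA₂, hB₂]
      | rw [← lie_skew]
        simp only [D.H_Hp, D.H_E, D.H_P, D.H_A₁, D.H_B₁, D.H_A₂, D.H_B₂, D.Hp_E, D.Hp_P,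
          D.Hp_A₁, D.Hp_B₁, D.Hp_A₂, D.Hp_B₂, D.E_P, D.A₁_E, D.E_B₁, D.A₂_E, D.E_B₂, D.P_A₁,
          D.P_B₁, D.P_A₂, D.P_B₂, D.A₁_B₁, D.A₁_A₂, D.A₁_B₂, D.A₂_B₁, D.B₁_B₂, D.A₂_B₂, neg_neg,
          Submodule.zero_mem, Submodule.neg_mem_iff, Submodule.smul_mem, hE, hP, hA₁, hB₁, hA₂, hB₂]
  induction hx using Submodule.span_induction with
  | zero => rw [zero_lie]; exact S.zero_mem
  | add a b _ _ ha hb => rw [add_lie]; exact S.add_mem ha hb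
  | smul c a _ ha => rw [smul_lie]; exact S.smul_mem c ha
  | mem z hz =>
    induction hy using Submodule.span_induction with
    | zero => rw [lie_zero]; exact S.zero_mem
    | add a b _ _ ha hb => rw [lie_add]; exact S.add_mem ha hb
    | smul c a _ ha => rw [lie_smul]; exact S.smul_mem c ha
    | mem w hw => exact key z hz w hw

/-- The carrier algebra. -/
def carrier (D : CarrierRelations K H Hp E P A₁ B₁ A₂ B₂) : LieSubalgebra K g where
  __ := Submodule.span K {H, Hp, E, P, A₁, B₁, A₂, B₂}
  lie_mem' := D.lie_mem_span

variable [CharZero K]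

/-- Suitable iterated brackets reduce a vanishing combination to a multiple of P with one unknown
coefficient: ad P isolates that of H_⊥, ad A₁ ad B₁ that of H, ad A₂ ad A₁ that of E, and single
brackets those of the A_i and B_i. -/
theorem linearIndependent (D : CarrierRelations K H Hp E P A₁ B₁ A₂ B₂) (hP : P ≠ 0) :
    LinearIndependent K ![H, Hp, E, P, A₁, B₁, A₂, B₂] := by
  rw [Fintype.linearIndependent_iff]
  intro c hc
  simp only [Fin.sum_univ_eight, Matrix.cons_val] at hc
  have zero_of_smul : ∀ {r : K}, r • P = 0 → r = 0 := fun h => (smul_eq_zero.mp h).resolve_right hP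
  have hPH := lie_eq_zero_symm D.H_P
  have hPE := lie_eq_zero_symm D.E_P
  have hA₁P := lie_eq_zero_symm D.P_A₁
  have hA₂P := lie_eq_zero_symm D.P_A₂
  have hPHp : ⁅P, Hp⁆ = -P := by rw [← lie_skew, D.Hp_P]
  have hA₁H : ⁅A₁, H⁆ = (2 : K)⁻¹ • A₁ := by rw [← lie_skew, D.H_A₁, neg_neg]
  have hA₂H : ⁅A₂, H⁆ = (2 : K)⁻¹ • A₂ := by rw [← lie_skew, D.H_A₂, neg_neg]
  have hA₁Hp : ⁅A₁, Hp⁆ = -((2 : K)⁻¹ • A₁) := by rw [← lie_skew, D.Hp_A₁]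
  have hA₂Hp : ⁅A₂, Hp⁆ = -((2 : K)⁻¹ • A₂) := by rw [← lie_skew, D.Hp_A₂]
  have hA₂A₁ := lie_eq_zero_symm D.A₁_A₂
  have hB₁H : ⁅B₁, H⁆ = -((2 : K)⁻¹ • B₁) := by rw [← lie_skew, D.H_B₁]
  have hB₁E := lie_eq_zero_symm D.E_B₁
  have hB₁P := lie_eq_zero_symm D.P_B₁
  have hB₁A₁ : ⁅B₁, A₁⁆ = -P := by rw [← lie_skew, D.A₁_B₁]
  have hB₁A₂ := lie_eq_zero_symm D.A₂_B₁
  have hB₂E := lie_eq_zero_symm D.E_B₂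
  have hB₂P := lie_eq_zero_symm D.P_B₂
  have hB₂B₁ := lie_eq_zero_symm D.B₁_B₂
  have hB₂A₁ := lie_eq_zero_symm D.A₁_B₂
  have hB₂A₂ : ⁅B₂, A₂⁆ = -P := by rw [← lie_skew, D.A₂_B₂]
  have h1 : c 1 = 0 := by
    have h := congrArg (fun x => ⁅P, x⁆) hc
    simp only [lie_add, lie_smul, hPH, hPHp, hPE, lie_self, D.P_A₁, D.P_B₁, D.P_A₂, D.P_B₂,
      smul_zero, zero_add, add_zero, lie_zero, smul_neg, neg_eq_zero] at h
    exact zero_of_smul h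
  rw [h1, zero_smul, add_zero] at hc
  have hB₁c := congrArg (fun x => ⁅B₁, x⁆) hc
  simp only [lie_add, lie_smul, hB₁H, hB₁E, hB₁P, lie_self, hB₁A₁, hB₁A₂, D.B₁_B₂,
    smul_zero, add_zero, lie_zero, smul_neg] at hB₁c
  have h0 : c 0 = 0 := by
    have h := congrArg (fun x => ⁅A₁, x⁆) hB₁c
    simp only [lie_add, lie_neg, lie_smul, D.A₁_B₁, hA₁P, smul_zero, neg_zero, add_zero, lie_zero,
      neg_eq_zero, smul_smul] at h
    exact (mul_eq_zero.mp (zero_of_smul h)).resolve_right (inv_ne_zero two_ne_zero)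
  rw [h0, zero_smul, neg_zero, zero_add, neg_eq_zero] at hB₁c
  have h4 := zero_of_smul hB₁c
  rw [h0, h4, zero_smul, zero_smul, zero_add, add_zero] at hc
  have h6 : c 6 = 0 := by
    have h := congrArg (fun x => ⁅B₂, x⁆) hc
    simp only [lie_add, lie_smul, hB₂E, hB₂P, lie_self, hB₂B₁, hB₂A₂,
      smul_zero, zero_add, add_zero, lie_zero, smul_neg, neg_eq_zero] at h
    exact zero_of_smul h
  rw [h6, zero_smul, add_zero] at hc
  have hA₁c := congrArg (fun x => ⁅A₁, x⁆) hc
  simp only [lie_add, lie_smul, D.A₁_E, hA₁P, D.A₁_B₁, D.A₁_B₂, smul_zero, add_zero, lie_zero,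
    smul_neg] at hA₁c
  have h2 : c 2 = 0 := by
    have h := congrArg (fun x => ⁅A₂, x⁆) hA₁c
    simp only [lie_add, lie_neg, lie_smul, D.A₂_B₂, hA₂P, smul_zero, add_zero, lie_zero,
      neg_eq_zero] at h
    exact zero_of_smul h
  rw [h2, zero_smul, neg_zero, zero_add] at hA₁c
  have h5 := zero_of_smul hA₁c
  rw [h2, h5, zero_smul, zero_smul, zero_add, add_zero] at hc
  have h7 : c 7 = 0 := by
    have h := congrArg (fun x => ⁅A₂, x⁆) hc
    simp only [lie_add, lie_smul, hA₂P, D.A₂_B₂, smul_zero, zero_add, lie_zero] at h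
    exact zero_of_smul h
  rw [h7, zero_smul, add_zero] at hc
  have h3 := zero_of_smul hc
  intro i
  fin_cases i <;> assumption

theorem finrank_carrier (D : CarrierRelations K H Hp E P A₁ B₁ A₂ B₂) (hP : P ≠ 0) :
    Module.finrank K D.carrier = 8 := by
  have h := finrank_span_eq_card (D.linearIndependent hP)
  have e : Set.range ![H, Hp, E, P, A₁, B₁, A₂, B₂] = {H, Hp, E, P, A₁, B₁, A₂, B₂} := by
    simp only [Matrix.range_cons, Matrix.range_empty, Set.union_empty, Set.singleton_union]
  rw [e, Fintype.card_fin] at h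
  exact h

theorem isSupportedOn_carrier (D : CarrierRelations K H Hp E P A₁ B₁ A₂ B₂) :
    IsSupportedOn (jordanianFactor H (deformedE (K := K) E B₂ B₁ P) *
    (extensionFactor (K := K) A₁ B₁ P * (extensionFactor A₂ B₂ P * jordanianFactor Hp (emb P))))
    D.carrier := by
  have hs : ∀ z ∈ ({H, Hp, E, P, A₁, B₁, A₂, B₂} : Set g), z ∈ D.carrier :=
    fun z hz => Submodule.subset_span hz
  simp only [Set.mem_insert_iff, Set.mem_singleton_iff, forall_eq_or_imp, forall_eq] at hs
  obtain ⟨hH, hHp, hE, hP, hA₁, hB₁, hA₂, hB₂⟩ := hs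
  rw [isSupportedOn_iff]
  exact Subring.mul_mem _
    (jordanianFactor_mem_seriesOver hH (deformedE_mem_seriesOver hE hB₂ hB₁ hP))
    (Subring.mul_mem _ (extensionFactor_mem_seriesOver hA₁ hB₁ hP)
      (Subring.mul_mem _ (extensionFactor_mem_seriesOver hA₂ hB₂ hP)
        (jordanianFactor_mem_seriesOver hHp (emb_mem_seriesOver hP))))

variable [FiniteDimensional K g] [LieAlgebra.IsKilling K g]

attribute [local instance 100] LieRing.ofAssociativeRing

local notation "ι" => UniversalEnvelopingAlgebra.ι

theorem linearIndependent_ι (D : CarrierRelations K H Hp E P A₁ B₁ A₂ B₂) (hP : P ≠ 0) :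
    LinearIndependent K fun i => (ι K (![H, Hp, E, P, A₁, B₁, A₂, B₂] i) : U K g) :=
  (D.linearIndependent hP).map' (ι K : g →ₗ⁅K⁆ U K g).toLinearMap
    (LinearMap.ker_eq_bot.mpr ι_injective)

theorem isCarrier (D : CarrierRelations K H Hp E P A₁ B₁ A₂ B₂) (hP : P ≠ 0) :
    IsCarrier (jordanianFactor H (deformedE (K := K) E B₂ B₁ P) *
    (extensionFactor (K := K) A₁ B₁ P * (extensionFactor A₂ B₂ P * jordanianFactor Hp (emb P))))
    D.carrier := by
  refine ⟨D.isSupportedOn_carrier, fun d hd => ?_⟩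
  have h1 := hd 1
  -- All factors have constant term 1, so their ħ-coefficients add up to H⊗E + A₁⊗B₁ + A₂⊗B₂ +
  -- H_⊥⊗P.
  rw [coeff_one_mul_of_constantCoeff, coeff_one_mul_of_constantCoeff,
    coeff_one_mul_of_constantCoeff, coeff_one_jordanianFactor, coeff_one_jordanianFactor,
    coeff_one_extensionFactor, coeff_one_extensionFactor, constantCoeff_deformedE,
    constantCoeff_emb] at h1
  rotate_left
  · exact constantCoeff_hExp _
  · exact constantCoeff_hExp _
  · exact constantCoeff_hExp _
  · rw [map_mul]; simp [extensionFactor, jordanianFactor]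
  · exact constantCoeff_hExp _
  · rw [map_mul, map_mul]; simp [extensionFactor, jordanianFactor]
  -- A linear left inverse supplies functionals on U(g) dual to the eight vectors.
  obtain ⟨f, hf⟩ := (Finsupp.linearCombination K
    fun i => (ι K (![H, Hp, E, P, A₁, B₁, A₂, B₂] i) : U K g)).exists_leftInverse_of_injective
    (linearIndependent_iff_ker.mp (D.linearIndependent_ι hP))
  have hφ : ∀ i j : Fin 8, (Finsupp.lapply i ∘ₗ f) (ι K (![H, Hp, E, P, A₁, B₁, A₂, B₂] j)) =
      if j = i then 1 else 0 := by
    intro i j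
    have h := LinearMap.congr_fun hf (Finsupp.single j 1)
    rw [LinearMap.comp_apply, Finsupp.linearCombination_single, one_smul] at h
    rw [LinearMap.comp_apply, h, LinearMap.id_apply, Finsupp.lapply_apply, Finsupp.single_apply]
  have hl := fun i => lid_rTensor_mem_range (Finsupp.lapply i ∘ₗ f) h1
  have hr := fun i => rid_lTensor_mem_range (Finsupp.lapply i ∘ₗ f) h1
  have a0 := fun i => hφ i 0
  have a1 := fun i => hφ i 1
  have a2 := fun i => hφ i 2
  have a3 := fun i => hφ i 3
  have a4 := fun i => hφ i 4
  have a5 := fun i => hφ i 5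
  have a6 := fun i => hφ i 6
  have a7 := fun i => hφ i 7
  simp only [Matrix.cons_val] at a0 a1 a2 a3 a4 a5 a6 a7
  -- The left legs are H, H_⊥, A₁, A₂ (indices 0, 1, 4, 6) and the right legs E, P, B₁, B₂ (2, 3, 5,
  -- 7). Testing one leg against its dual functional leaves its partner.
  simp only [map_add, LinearMap.rTensor_tmul, TensorProduct.lid_tmul, a0, a1, a4, a6] at hl
  simp only [map_add, LinearMap.lTensor_tmul, TensorProduct.rid_tmul, a2, a3, a5, a7] at hr
  have hs : ∀ z ∈ ({H, Hp, E, P, A₁, B₁, A₂, B₂} : Set g), z ∈ d := by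
    simp only [Set.mem_insert_iff, Set.mem_singleton_iff, forall_eq_or_imp, forall_eq]
    refine ⟨mem_of_ι_mem_range ?_, mem_of_ι_mem_range ?_, mem_of_ι_mem_range ?_,
      mem_of_ι_mem_range ?_, mem_of_ι_mem_range ?_, mem_of_ι_mem_range ?_, mem_of_ι_mem_range ?_,
      mem_of_ι_mem_range ?_⟩
    · simpa using hr 2
    · simpa using hr 3
    · simpa using hl 0
    · simpa using hl 1
    · simpa using hr 5
    · simpa using hl 4
    · simpa using hr 7
    · simpa using hl 6
  exact Submodule.span_le (p := d.toSubmodule).mpr hs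

theorem isBorelBasis (D : CarrierRelations K H Hp E P A₁ B₁ A₂ B₂) (hP : P ≠ 0) :
    IsBorelBasis (emb H) (deformedE (K := K) E B₂ B₁ P) where
  lie_eq := by rw [D.emb_mul_deformedE, add_sub_cancel_left]
  independent := by
    intro p q h
    have hind : ∀ r s : K, r • (ι K H : U K g) + s • (ι K E : U K g) = 0 → r = 0 ∧ s = 0 := by
      intro r s hrs
      have h1 := Fintype.linearIndependent_iff.mp (D.linearIndependent_ι hP)
        ![r, 0, s, 0, 0, 0, 0, 0]
        (by simpa [Fin.sum_univ_eight] using hrs)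
      exact ⟨h1 0, h1 2⟩
    -- Once all lower coefficients of p and q vanish, the n-th coefficient of the relation involves
    -- only the constant terms H and E of the two elements, which are independent over K.
    have key : ∀ n, coeff n p = 0 ∧ coeff n q = 0 := by
      intro n
      induction n using Nat.strong_induction_on with
      | _ n ih =>
      apply hind
      have hn := congrArg (coeff n) h
      rw [map_add, map_zero, coeff_mul, coeff_mul, Finset.sum_eq_single (n, 0),
        Finset.sum_eq_single (n, 0)] at hn
      · simp only [coeff_map, coeff_zero_eq_constantCoeff_apply, constantCoeff_emb,
          constantCoeff_deformedE, ← Algebra.smul_def] at hn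
        exact hn
      · rintro ⟨i, j⟩ hij hne
        rw [Finset.HasAntidiagonal.mem_antidiagonal] at hij
        have hi : i < n := by
          rcases Nat.eq_zero_or_pos j with rfl | hj
          · exact absurd (by simpa using hij) hne
          · simp only at hij; omega
        simp [coeff_map, (ih i hi).2]
      · simp
      · rintro ⟨i, j⟩ hij hne
        rw [Finset.HasAntidiagonal.mem_antidiagonal] at hij
        have hi : i < n := by
          rcases Nat.eq_zero_or_pos j with rfl | hj
          · exact absurd (by simpa using hij) hne
          · simp only at hij; omega
        simp [coeff_map, (ih i hi).1]
      · simp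
    exact ⟨PowerSeries.ext fun n => by simp [(key n).1],
      PowerSeries.ext fun n => by simp [(key n).2]⟩

end CarrierRelations

end JordanianTwist

/-! ### Root strings, weights, and the derivation of the brackets. -/

namespace JordanianTwist

section RootLemmas

open LieAlgebra LieModule

variable {K g : Type*} [Field K] [LieRing g] [LieAlgebra K g]
  {h : LieSubalgebra K g} [h.IsCartanSubalgebra]

theorem isRoot_of_weight {α : Weight K h g} (hα : α.IsNonZero) {χ : Module.Dual K h}
    (h1 : (α : h → K) = χ) : IsRoot h χ := by
  refine ⟨fun h0 => hα ?_, h1 ▸ α.genWeightSpace_ne_bot⟩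
  rw [h0] at h1
  exact h1

/-- `IsRoot` excludes 0 by definition, so nonvanishing of the functional has to be supplied
separately each time. -/
theorem rootSpace_eq_bot {χ : Module.Dual K h} (h0 : χ ≠ 0) (h1 : ¬ IsRoot h χ) :
    rootSpace h (χ : h → K) = ⊥ := by
  by_contra h2
  exact h1 ⟨h0, h2⟩

theorem lie_eq_zero_of_not_isRoot {χ ψ : Module.Dual K h} {x y : g}
    (hx : x ∈ rootSpace h (χ : h → K)) (hy : y ∈ rootSpace h (ψ : h → K)) (h0 : χ + ψ ≠ 0)
    (h1 : ¬ IsRoot h (χ + ψ)) : ⁅x, y⁆ = 0 := by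
  have h2 : ⁅x, y⁆ ∈ rootSpace h ((χ + ψ : Module.Dual K h) : h → K) :=
    lie_mem_genWeightSpace_of_mem_genWeightSpace hx hy
  rwa [rootSpace_eq_bot h0 h1, LieSubmodule.mem_bot] at h2

variable [FiniteDimensional K g]

theorem cartanEquivDual_symm_apply_comm [LieAlgebra.IsKilling K g] (χ ψ : Module.Dual K h) :
    χ ((IsKilling.cartanEquivDual h).symm ψ) = ψ ((IsKilling.cartanEquivDual h).symm χ) := by
  have key : ∀ a b : h, IsKilling.cartanEquivDual h a b = IsKilling.cartanEquivDual h b a :=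
    fun a b => LieModule.traceForm_comm K h g a b
  have := key ((IsKilling.cartanEquivDual h).symm χ) ((IsKilling.cartanEquivDual h).symm ψ)
  rwa [LinearEquiv.apply_symm_apply, LinearEquiv.apply_symm_apply] at this

variable [CharZero K]

theorem IsRoot.exists_weight {χ : Module.Dual K h} (hχ : IsRoot h χ) :
    ∃ α : Weight K h g, α.IsNonZero ∧ (α : h → K) = χ ∧ Weight.toLinear K h g α = χ := by
  refine ⟨⟨χ, hχ.2⟩, fun h0 => hχ.1 ?_, rfl, rfl⟩
  ext x
  exact congrFun h0 x

variable [LieAlgebra.IsKilling K g] [LieModule.IsTriangularizable K h g]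

theorem IsRoot.neg {χ : Module.Dual K h} (hχ : IsRoot h χ) : IsRoot h (-χ) := by
  obtain ⟨α, hα, h1, -⟩ := hχ.exists_weight
  exact isRoot_of_weight hα.neg (by rw [Weight.coe_neg, h1]; rfl)

theorem IsRoot.not_two_smul {χ : Module.Dual K h} (hχ : IsRoot h χ) : ¬ IsRoot h (χ + χ) := by
  obtain ⟨α, hα, h1, -⟩ := hχ.exists_weight
  intro h2
  refine h2.2 ?_
  have := IsKilling.rootSpace_two_smul α hα
  rwa [h1, two_smul] at this

theorem cartanGen_lie {χ : Module.Dual K h} {x : g} (hx : x ∈ rootSpace h (χ : h → K)) (a : h) :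
    ⁅(a : g), x⁆ = χ a • x :=
  IsKilling.lie_eq_smul_of_mem_rootSpace hx a

theorem IsRoot.apply_cartanEquivDual_symm_ne_zero {χ : Module.Dual K h} (hχ : IsRoot h χ) :
    χ ((IsKilling.cartanEquivDual h).symm χ) ≠ 0 := by
  obtain ⟨α, hα, -, rfl⟩ := hχ.exists_weight
  exact IsKilling.root_apply_cartanEquivDual_symm_ne_zero hα

theorem IsRoot.apply_cartanGen_self {χ : Module.Dual K h} (hχ : IsRoot h χ) :
    χ (cartanGen h χ) = 1 := by
  rw [cartanGen, map_smul, smul_eq_mul, inv_mul_cancel₀ hχ.apply_cartanEquivDual_symm_ne_zero]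

/-- Orthogonality is symmetric because the Killing form is. -/
theorem apply_cartanGen_eq_zero_symm {χ ψ : Module.Dual K h} (hχ : IsRoot h χ)
    (h0 : ψ (cartanGen h χ) = 0) : χ (cartanGen h ψ) = 0 := by
  rw [cartanGen, map_smul, smul_eq_mul, mul_eq_zero] at h0
  rw [cartanGen, map_smul, smul_eq_mul, cartanEquivDual_symm_apply_comm χ ψ,
    h0.resolve_left (inv_ne_zero hχ.apply_cartanEquivDual_symm_ne_zero), mul_zero]

/-- The top of a `δ`-series of length two takes the value `1/2` on `H_δ`. -/
theorem apply_cartanGen_eq_half {χ δ : Module.Dual K h} (hχ : IsRoot h χ) (hδ : IsRoot h δ)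
    (h1 : rootSpace h ((χ + δ : Module.Dual K h) : h → K) = ⊥) (h2 : IsRoot h (χ - δ))
    (h3 : rootSpace h ((χ - δ - δ : Module.Dual K h) : h → K) = ⊥) :
    χ (cartanGen h δ) = (2 : K)⁻¹ := by
  obtain ⟨α, hα, e1, e2⟩ := hδ.exists_weight
  obtain ⟨β, hβ, e3, -⟩ := hχ.exists_weight
  have t1 := (IsKilling.rootSpace_zsmul_add_ne_bot_iff α β hα 1).not
  have t2 := IsKilling.rootSpace_zsmul_add_ne_bot_iff α β hα (-1)
  have t3 := (IsKilling.rootSpace_zsmul_add_ne_bot_iff α β hα (-2)).not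
  have f1 : (1 : ℤ) • (α : h → K) + β = ((χ + δ : Module.Dual K h) : h → K) := by
    rw [e1, e3]; ext x; simp [add_comm]
  have f2 : (-1 : ℤ) • (α : h → K) + β = ((χ - δ : Module.Dual K h) : h → K) := by
    rw [e1, e3]; ext x; simp; ring
  have f3 : (-2 : ℤ) • (α : h → K) + β = ((χ - δ - δ : Module.Dual K h) : h → K) := by
    rw [e1, e3]; ext x; simp; ring
  rw [f1, not_not] at t1
  rw [f2] at t2
  rw [f3, not_not] at t3
  have g1 := t1.mp h1
  have g2 := t2.mp h2.2
  have g3 := t3.mp h3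
  -- The string reaches one step down and none up, so the coroot takes the value 1 and its half the
  -- value 1/2.
  have hbt : (chainBotCoeff α β - chainTopCoeff α β : ℤ) = 1 := by omega
  have hc := IsKilling.apply_coroot_eq_cast α β
  rw [hbt, ← two_smul_cartanGen, e2, e3, map_nsmul, Int.cast_one, nsmul_eq_mul] at hc
  exact eq_inv_of_mul_eq_one_right (by simpa using hc)

/-- Up to sign, the conditions on δ - μ say that μ - δ is a root and μ - 2δ is not, so μ is the top
of a δ-series of length two. The zero cases are excluded because 2δ is not a root. -/
theorem apply_cartanGen_of_mem_constituentRoots {δ μ : Module.Dual K h} (hδ : IsRoot h δ)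
    (hμ : μ ∈ constituentRoots h δ) : μ (cartanGen h δ) = (2 : K)⁻¹ := by
  obtain ⟨h1, h2, h3, h4⟩ := hμ
  have h2' : IsRoot h (μ - δ) := by simpa using h2.neg
  refine apply_cartanGen_eq_half h1 hδ (rootSpace_eq_bot (fun h0 => ?_) h3) h2'
    (rootSpace_eq_bot (fun h0 => ?_) fun h5 => h4 ?_)
  · rw [eq_neg_of_add_eq_zero_left h0, sub_neg_eq_add] at h2
    exact hδ.not_two_smul h2
  · rw [sub_sub, sub_eq_zero] at h0
    rw [h0] at h1
    exact hδ.not_two_smul h1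
  · have e : -(μ - δ - δ) = δ - μ + δ := by abel
    exact e ▸ h5.neg

/-- The brackets of the root vectors involved in the extended Jordanian twist. -/
theorem carrierRelations_of_roots (L : Module.Dual K h → g)
    (hL : ∀ χ, IsRoot h χ → L χ ∈ rootSpace h (χ : h → K) ∧ L χ ≠ 0)
    {l0 lp l1 l2 : Module.Dual K h} (hl0 : IsRoot h l0) (hlp : IsRoot h lp)
    (horth : lp (cartanGen h l0) = 0)
    (hl1 : l1 ∈ constituentRoots h lp) (hl2 : l2 ∈ constituentRoots h lp)
    (hshift : l1 + l0 = lp - l2) (hne : l1 ≠ l2)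
    (honly : ∀ μ ∈ ({l1, l2, lp - l1, lp - l2} : Set (Module.Dual K h)),
      ∀ ν ∈ ({l1, l2, lp - l1, lp - l2} : Set (Module.Dual K h)), IsRoot h (μ + ν) → μ + ν = lp)
    (hshort : ∀ χ, ¬ (IsRoot h χ ∧ IsRoot h (χ + l0) ∧ IsRoot h (χ + l0 + l0)))
    (hn1 : ⁅L l1, L (lp - l1)⁆ = L lp) (hn2 : ⁅L l2, L (lp - l2)⁆ = L lp)
    (hC : ⁅L l1, L l0⁆ = -L (lp - l2)) :
    CarrierRelations K (cartanGen h l0 : g) (cartanGen h lp : g) (L l0) (L lp) (L l1) (L (lp - l1))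
      (L l2) (L (lp - l2)) := by
  have hshift' : l2 + l0 = lp - l1 := by
    rw [eq_sub_iff_add_eq] at hshift ⊢
    rw [← hshift]; abel
  have half : (1 : K) - 2⁻¹ = 2⁻¹ := by norm_num
  -- the values of the roots on the Cartan generators
  have lp_Hp := hlp.apply_cartanGen_self
  have l0_H := hl0.apply_cartanGen_self
  have l0_Hp := apply_cartanGen_eq_zero_symm hl0 horth
  have l1_Hp := apply_cartanGen_of_mem_constituentRoots hlp hl1
  have l2_Hp := apply_cartanGen_of_mem_constituentRoots hlp hl2
  have m1_Hp : (lp - l1) (cartanGen h lp) = (2 : K)⁻¹ := by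
    rw [LinearMap.sub_apply, lp_Hp, l1_Hp, half]
  have m2_Hp : (lp - l2) (cartanGen h lp) = (2 : K)⁻¹ := by
    rw [LinearMap.sub_apply, lp_Hp, l2_Hp, half]
  have ne_zero : ∀ {χ : Module.Dual K h}, χ (cartanGen h lp) ≠ 0 → χ ≠ 0 := by
    rintro _ h0 rfl
    exact h0 rfl
  -- Since l0-series are short, ν = μ + l0 tops a series of length two. Values on H_⊥, where l0
  -- vanishes, show that the functionals involved are nonzero.
  have value_H : ∀ {μ ν : Module.Dual K h}, IsRoot h μ → IsRoot h ν → μ + l0 = ν →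
      μ (cartanGen h lp) = (2 : K)⁻¹ → ν (cartanGen h l0) = (2 : K)⁻¹ := by
    rintro μ _ hμ hν rfl hv
    refine apply_cartanGen_eq_half hν hl0 (rootSpace_eq_bot (ne_zero ?_) fun h1 => ?_) ?_
      (rootSpace_eq_bot (ne_zero ?_) fun h1 => ?_)
    · simp [hv, l0_Hp]
    · exact hshort μ ⟨hμ, hν, h1⟩
    · rwa [add_sub_cancel_right]
    · simp [hv, l0_Hp]
    · rw [add_sub_cancel_right] at h1
      exact hshort (μ - l0) ⟨h1, by rwa [sub_add_cancel], by rwa [sub_add_cancel]⟩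
  have m2_H := value_H hl1.1 hl2.2.1 hshift l1_Hp
  have m1_H := value_H hl2.1 hl1.2.1 hshift' l2_Hp
  have l1_H : l1 (cartanGen h l0) = -(2 : K)⁻¹ := by
    rw [LinearMap.sub_apply, horth, zero_sub] at m1_H
    rw [← m1_H, neg_neg]
  have l2_H : l2 (cartanGen h l0) = -(2 : K)⁻¹ := by
    rw [LinearMap.sub_apply, horth, zero_sub] at m2_H
    rw [← m2_H, neg_neg]
  -- the root vectors
  have r0 := (hL _ hl0).1
  have rp := (hL _ hlp).1
  have r1 := (hL _ hl1.1).1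
  have r2 := (hL _ hl2.1).1
  have s1 := (hL _ hl1.2.1).1
  have s2 := (hL _ hl2.2.1).1
  have ne_lp : ∀ {χ : Module.Dual K h}, χ (cartanGen h l0) ≠ 0 → χ ≠ lp := by
    rintro _ h0 rfl
    exact h0 horth
  have hA : ⁅L l1, L l2⁆ = 0 := by
    refine lie_eq_zero_of_not_isRoot r1 r2 (ne_zero ?_) fun h1 => ne_lp ?_
      (honly l1 (by simp) l2 (by simp) h1)
    · simp [l1_Hp, l2_Hp, ← two_mul]
    · simp [l1_H, l2_H, ← two_mul]
  have not_root_sum : ¬ IsRoot h ((lp - l1) + (lp - l2)) := fun h1 => by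
    refine ne_lp ?_ (honly (lp - l1) (by simp) (lp - l2) (by simp) h1)
    rw [LinearMap.add_apply, m1_H, m2_H]
    simp [← two_mul]
  -- The second structure constant is forced by the first: the bracket is c·B₁ because the root
  -- space is a line, and bracketing with A₁ gives cP = [A₂,[A₁,E]] = -[A₂,B₂] = -P by the Jacobi
  -- identity.
  have A₂_E : ⁅L l2, L l0⁆ = -L (lp - l1) := by
    have hm : ⁅L l2, L l0⁆ ∈ rootSpace h ((lp - l1 : Module.Dual K h) : h → K) := by
      rw [← hshift']
      exact lie_mem_genWeightSpace_of_mem_genWeightSpace r2 r0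
    obtain ⟨α, hα, e1, -⟩ := hl1.2.1.exists_weight
    have h1 := IsKilling.finrank_rootSpace_eq_one α hα
    rw [e1] at h1
    obtain ⟨c, hc⟩ := (finrank_eq_one_iff_of_nonzero'
      (⟨L (lp - l1), s1⟩ : rootSpace h ((lp - l1 : Module.Dual K h) : h → K))
      (fun h0 => (hL _ hl1.2.1).2 (congrArg Subtype.val h0))).mp h1 ⟨_, hm⟩
    replace hc : c • L (lp - l1) = ⁅L l2, L l0⁆ := congrArg Subtype.val hc
    have hj := leibniz_lie (L l1) (L l2) (L l0)
    rw [hA, zero_lie, zero_add, hC, lie_neg, hn2, ← hc, lie_smul, hn1] at hj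
    have hc1 : (c + 1) • L lp = 0 := by rw [add_smul, one_smul, hj, neg_add_cancel]
    have hc2 := eq_neg_of_add_eq_zero_left ((smul_eq_zero.mp hc1).resolve_right (hL _ hlp).2)
    rw [← hc, hc2, neg_one_smul]
  have not_root_l0 : ∀ {μ ν : Module.Dual K h}, IsRoot h μ → IsRoot h ν → μ + l0 = ν →
      ¬ IsRoot h (l0 + ν) := by
    rintro μ _ hμ hν rfl h1
    rw [add_comm] at h1
    exact hshort μ ⟨hμ, hν, h1⟩
  exact
  { H_Hp := by
      have h1 : ⁅cartanGen h l0, cartanGen h lp⁆ = 0 := trivial_lie_zero h h _ _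
      exact congrArg Subtype.val h1
    H_E := by rw [cartanGen_lie r0, l0_H, one_smul]
    H_P := by rw [cartanGen_lie rp, horth, zero_smul]
    H_A₁ := by rw [cartanGen_lie r1, l1_H, neg_smul]
    H_B₁ := by rw [cartanGen_lie s1, m1_H]
    H_A₂ := by rw [cartanGen_lie r2, l2_H, neg_smul]
    H_B₂ := by rw [cartanGen_lie s2, m2_H]
    Hp_E := by rw [cartanGen_lie r0, l0_Hp, zero_smul]
    Hp_P := by rw [cartanGen_lie rp, lp_Hp, one_smul]
    Hp_A₁ := by rw [cartanGen_lie r1, l1_Hp]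
    Hp_B₁ := by rw [cartanGen_lie s1, m1_Hp]
    Hp_A₂ := by rw [cartanGen_lie r2, l2_Hp]
    Hp_B₂ := by rw [cartanGen_lie s2, m2_Hp]
    E_P := by
      refine lie_eq_zero_of_not_isRoot r0 rp (ne_zero (by simp [l0_Hp, lp_Hp])) fun h1 => ?_
      -- The sum l0 + lp equals (lp - l1) + (lp - l2), which was excluded as a root by its nonzero
      -- value on H.
      refine not_root_sum ?_
      rwa [← hshift', add_assoc, add_comm l0, ← add_assoc, add_sub_cancel, add_comm]
    A₁_E := hC
    E_B₁ := lie_eq_zero_of_not_isRoot r0 s1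
      (ne_zero (by rw [LinearMap.add_apply, m1_Hp, l0_Hp]; simp))
      (not_root_l0 hl2.1 hl1.2.1 hshift')
    A₂_E := A₂_E
    E_B₂ := lie_eq_zero_of_not_isRoot r0 s2
      (ne_zero (by rw [LinearMap.add_apply, m2_Hp, l0_Hp]; simp))
      (not_root_l0 hl1.1 hl2.2.1 hshift)
    P_A₁ := lie_eq_zero_of_not_isRoot rp r1
      (ne_zero (by rw [LinearMap.add_apply, lp_Hp, l1_Hp]; norm_num))
      (by rw [add_comm]; exact hl1.2.2.1)
    P_B₁ := lie_eq_zero_of_not_isRoot rp s1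
      (ne_zero (by rw [LinearMap.add_apply, lp_Hp, m1_Hp]; norm_num))
      (by rw [add_comm]; exact hl1.2.2.2)
    P_A₂ := lie_eq_zero_of_not_isRoot rp r2
      (ne_zero (by rw [LinearMap.add_apply, lp_Hp, l2_Hp]; norm_num))
      (by rw [add_comm]; exact hl2.2.2.1)
    P_B₂ := lie_eq_zero_of_not_isRoot rp s2
      (ne_zero (by rw [LinearMap.add_apply, lp_Hp, m2_Hp]; norm_num))
      (by rw [add_comm]; exact hl2.2.2.2)
    A₁_B₁ := hn1
    A₁_A₂ := hA
    A₁_B₂ := by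
      refine lie_eq_zero_of_not_isRoot r1 s2
        (ne_zero (by rw [LinearMap.add_apply, l1_Hp, m2_Hp]; norm_num)) fun h1 => hne ?_
      have h2 := honly l1 (by simp) (lp - l2) (by simp) h1
      rw [add_sub_left_comm, add_eq_left, sub_eq_zero] at h2
      exact h2
    A₂_B₁ := by
      refine lie_eq_zero_of_not_isRoot r2 s1
        (ne_zero (by rw [LinearMap.add_apply, l2_Hp, m1_Hp]; norm_num)) fun h1 => hne ?_
      have h2 := honly l2 (by simp) (lp - l1) (by simp) h1
      rw [add_sub_left_comm, add_eq_left, sub_eq_zero] at h2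
      exact h2.symm
    B₁_B₂ := lie_eq_zero_of_not_isRoot s1 s2
      (ne_zero (by rw [LinearMap.add_apply, m1_Hp, m2_Hp]; norm_num)) not_root_sum
    A₂_B₂ := hn2 }

end RootLemmas

end JordanianTwist

open JordanianTwist in
theorem mainTheorem1 {K g : Type*} [Field K] [CharZero K] [LieRing g] [LieAlgebra K g]
    [FiniteDimensional K g] [LieAlgebra.IsKilling K g]
    (h : LieSubalgebra K g) [h.IsCartanSubalgebra] [LieModule.IsTriangularizable K h g]
    -- a root vector `L χ` for every root `χ`
    (L : Module.Dual K h → g)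
    (hL : ∀ χ, IsRoot h χ → L χ ∈ LieAlgebra.rootSpace h (χ : h → K) ∧ L χ ≠ 0)
    -- orthogonal roots `l0`, `lp`
    (l0 lp : Module.Dual K h) (hl0 : IsRoot h l0) (hlp : IsRoot h lp)
    (horth : lp (cartanGen h l0) = 0)
    -- two distinct constituent roots `l1`, `l2` of `lp` that the shift by `l0` sends to
    -- `lp - l2`, `lp - l1`
    (l1 l2 : Module.Dual K h) (hl1 : l1 ∈ constituentRoots h lp) (hl2 : l2 ∈ constituentRoots h lp)
    (hshift : l1 + l0 = lp - l2) (hne : l1 ≠ l2)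
    -- `lp` is the only root composed of two of the constituent roots involved
    (honly : ∀ μ ∈ ({l1, l2, lp - l1, lp - l2} : Set (Module.Dual K h)),
      ∀ ν ∈ ({l1, l2, lp - l1, lp - l2} : Set (Module.Dual K h)), IsRoot h (μ + ν) → μ + ν = lp)
    -- all `l0`-series of roots are short
    (hshort : ∀ χ, ¬ (IsRoot h χ ∧ IsRoot h (χ + l0) ∧ IsRoot h (χ + l0 + l0)))
    -- normalization of the structure constants
    (hn1 : ⁅L l1, L (lp - l1)⁆ = L lp) (hn2 : ⁅L l2, L (lp - l2)⁆ = L lp)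
    (hC : ⁅L l1, L l0⁆ = -L (lp - l2)) :
    let H : g := cartanGen h l0
    let Hp : g := cartanGen h lp
    let PhiJ := jordanianFactor (K := K) Hp (emb (L lp))
    let PhiE := extensionFactor (K := K) (L l1) (L (lp - l1)) (L lp) *
      extensionFactor (L l2) (L (lp - l2)) (L lp)
    let FBp := PhiE * PhiJ
    let EB := deformedE (K := K) (L l0) (L (lp - l2)) (L (lp - l1)) (L lp)
    let FBJE := jordanianFactor H EB * PhiE * PhiJ
    IsTwist FBp ∧
    IsPrimitiveFor FBp (emb H) ∧
    IsPrimitiveFor FBp EB ∧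
    IsBorelBasis (emb H) EB ∧
    IsTwist FBJE ∧
    ∃ c : LieSubalgebra K g,
      IsCarrier FBJE c ∧
      c.toSubmodule = Submodule.span K {H, Hp, L l0, L lp, L l1, L (lp - l1), L l2, L (lp - l2)} ∧
      Module.finrank K c = 8 := by
  intro H Hp PhiJ PhiE FBp EB FBJE
  have D : CarrierRelations K H Hp (L l0) (L lp) (L l1) (L (lp - l1)) (L l2) (L (lp - l2)) :=
    carrierRelations_of_roots L hL hl0 hlp horth hl1 hl2 hshift hne honly hshort hn1 hn2 hC
  have hP : L lp ≠ 0 := (hL lp hlp).2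
  have e1 : FBp = extensionFactor (L l1) (L (lp - l1)) (L lp) *
      (extensionFactor (L l2) (L (lp - l2)) (L lp) * jordanianFactor Hp (emb (L lp))) :=
    mul_assoc _ _ _
  have e2 : FBJE = jordanianFactor H EB * (extensionFactor (L l1) (L (lp - l1)) (L lp) *
      (extensionFactor (L l2) (L (lp - l2)) (L lp) * jordanianFactor Hp (emb (L lp)))) := by
    rw [← e1]
    exact mul_assoc _ _ _
  have hF : IsTwist FBp := e1 ▸ D.isTwist_extended
  refine ⟨hF, (isPrimitiveFor_iff hF.isUnit _).mpr (e1 ▸ D.semiconjBy_H),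
    (isPrimitiveFor_iff hF.isUnit _).mpr (e1 ▸ D.semiconjBy_deformedE), D.isBorelBasis hP,
    e2 ▸ D.isTwist_full, D.carrier, e2 ▸ D.isCarrier hP, rfl, D.finrank_carrier hP⟩
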